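/- Let $K$ be a field, $n>1$ and $A=K\langle x_1,\dots,x_n\rangle$ the free unital associative $K$-algebra of rank $n$. A Gabriel topology on $A$ is identified with its family of open right ideals; for such a topology $\mathfrak F$ let $A_{\mathfrak F}=\varinjlim_{R\in\mathfrak F}\operatorname{Hom}_A(R,A/t(A))$ be the ring of right quotients, where $t(A)$ is the $\mathfrak F$-torsion ideal of $A$, and let $\phi:A\to A_{\mathfrak F}$ be the canonical homomorphism. A flat bimorphism is a ring homomorphism $\psi:A\to B$ that is a monomorphism and an epimorphism of rings and makes $B$ a flat left $A$-module; it induces on $A$ the topology whose open right ideals are the right ideals $R$ with $\psi(R)B=B$. For a right ideal $I$ of $A$, the ideal topology defined by $I$ is the family of right ideals of $A$ that contain some power $I^l$, $l\in\mathbb N$. Let $L_K(1,n)$ be the $K$-algebra generated by $a_i,a_i^*$ $(1\le i\le n)$ with relations $\sum_i a_ia_i^*=1$ and $a_j^*a_i=\delta_{ij}$. (1) Let $I$ be a right ideal of $A$ of codimension $1$. Then the ideal topology $\mathfrak F$ defined by $I$ is a Gabriel topology, $\phi:A\to A_{\mathfrak F}$ is a flat bimorphism, and $\mathfrak F$ coincides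 with the topology induced by $\phi$. Moreover there is a $K$-algebra isomorphism $e:A_{\mathfrak F}\to L_K(1,n)$ with $e(\phi(x_i-c_i))=a_i$ for all $i$, where $c_i\in K$ is the scalar with $x_i-c_i\in I$; the composite $e\phi:A\to L_K(1,n)$ is a flat bimorphism, and $\mathfrak F$ coincides with the topology that it induces. (2) Let $I$ be an arbitrary two-sided ideal of $A$ of finite codimension. Then the ideal topology $\mathfrak F$ defined by $I$ is a Gabriel topology, the canonical homomorphism $A\to A_{\mathfrak F}$ is a flat bimorphism, and $\mathfrak F$ coincides with the topology induced by it. -/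

import Mathlib

open scoped TensorProduct

universe u v

/-! ### Right modules, right ideals and Gabriel topologies

Right `A`-modules are modules over `Aᵐᵒᵖ`; the right ideals of `A` are the submodules of `A`
viewed as a right module over itself. -/

/-- The right ideals of a ring. -/
abbrev RightIdeal (A : Type u) [Ring A] : Type u := Submodule Aᵐᵒᵖ A

/-- For a submodule `D` of a right `A`-module `M` and `m : M`, the right ideal
`(D : m) = {a | m a ∈ D}`. -/
def rightColon {A : Type u} [Ring A] {M : Type v} [AddCommGroup M] [Module Aᵐᵒᵖ M]
    (D : Submodule Aᵐᵒᵖ M) (m : M) : RightIdeal A where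
  carrier := {a | MulOpposite.op a • m ∈ D}
  add_mem' {a b} ha hb := by
    simp only [Set.mem_ofPred_eq, MulOpposite.op_add, add_smul] at *
    exact D.add_mem ha hb
  zero_mem' := by simp
  smul_mem' c a ha := by
    simp only [Set.mem_ofPred_eq] at *
    have h : MulOpposite.op (c • a) = c * MulOpposite.op a := by
      induction c using MulOpposite.rec' with | h c => simp
    rw [h, mul_smul]
    exact D.smul_mem c ha

theorem mem_rightColon {A : Type u} [Ring A] {M : Type v} [AddCommGroup M] [Module Aᵐᵒᵖ M]
    {D : Submodule Aᵐᵒᵖ M} {m : M} {a : A} :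
    a ∈ rightColon D m ↔ MulOpposite.op a • m ∈ D := Iff.rfl

/-- A (right) Gabriel topology on a ring, given by its family of open right ideals. -/
@[ext]
structure GabrielTopology (A : Type u) [Ring A] where
  /-- The family of open right ideals. -/
  sets : Set (RightIdeal A)
  top_mem : ⊤ ∈ sets
  mem_of_le : ∀ {R S : RightIdeal A}, R ∈ sets → R ≤ S → S ∈ sets
  inf_mem : ∀ {R S : RightIdeal A}, R ∈ sets → S ∈ sets → R ⊓ S ∈ sets
  colon_mem : ∀ {R : RightIdeal A}, R ∈ sets → ∀ a : A, rightColon R a ∈ sets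
  mem_of_colon_mem : ∀ {R S : RightIdeal A}, S ∈ sets → (∀ a ∈ S, rightColon R a ∈ sets) →
    R ∈ sets

namespace GabrielTopology

variable {A : Type u} [Ring A] (F : GabrielTopology A)

/-! ### The ring of partial endomorphisms with dense domain -/

section DenseEnd

variable {M : Type v} [AddCommGroup M] [Module Aᵐᵒᵖ M]

/-- A submodule `D` of `M` is dense if `M ⧸ D` is a torsion module, i.e. `(D : m)` is open for
every `m`. -/
def IsDense (D : Submodule Aᵐᵒᵖ M) : Prop := ∀ m : M, rightColon D m ∈ F.sets

variable {F}

theorem isDense_top : F.IsDense (⊤ : Submodule Aᵐᵒᵖ M) := fun _ =>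
  F.mem_of_le F.top_mem fun _ _ => Submodule.mem_top

theorem IsDense.mono {D E : Submodule Aᵐᵒᵖ M} (hD : F.IsDense D) (h : D ≤ E) : F.IsDense E :=
  fun m => F.mem_of_le (hD m) fun _ ha => h ha

theorem IsDense.inf {D E : Submodule Aᵐᵒᵖ M} (hD : F.IsDense D) (hE : F.IsDense E) :
    F.IsDense (D ⊓ E) :=
  fun m => F.mem_of_le (F.inf_mem (hD m) (hE m)) fun _ ha => ⟨ha.1, ha.2⟩

variable (F M)

/-- The partial endomorphisms of the right module `M` with dense domain. -/
def PartialEnd : Type v := {f : M →ₗ.[Aᵐᵒᵖ] M // F.IsDense f.domain}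

variable {F M}

/-- Composition of partial endomorphisms, defined on `{x ∈ dom g | g x ∈ dom f}`. -/
def pcomp (f g : M →ₗ.[Aᵐᵒᵖ] M) : M →ₗ.[Aᵐᵒᵖ] M where
  domain := (f.domain.comap g.toFun).map g.domain.subtype
  toFun :=
    { toFun := fun x => f ⟨g ⟨x.1, by obtain ⟨y, -, hy⟩ := x.2; exact hy ▸ y.2⟩, by
        obtain ⟨_, ⟨y, hy, rfl⟩⟩ := x; exact hy⟩
      map_add' := fun x y => by
        rw [← LinearPMap.map_add]; congr 1; ext
        exact LinearPMap.map_add g ⟨x.1, _⟩ ⟨y.1, _⟩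
      map_smul' := fun c x => by
        rw [RingHom.id_apply, ← LinearPMap.map_smul]; congr 1; ext
        exact LinearPMap.map_smul g c ⟨x.1, _⟩ }

theorem mem_pcomp {f g : M →ₗ.[Aᵐᵒᵖ] M} {x : M} :
    x ∈ (pcomp f g).domain ↔ ∃ h : x ∈ g.domain, g ⟨x, h⟩ ∈ f.domain := by
  constructor
  · rintro ⟨y, hy, rfl⟩; exact ⟨y.2, hy⟩
  · rintro ⟨h, h'⟩; exact ⟨⟨x, h⟩, h', rfl⟩

theorem isDense_pcomp {f g : M →ₗ.[Aᵐᵒᵖ] M} (hf : F.IsDense f.domain)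
    (hg : F.IsDense g.domain) : F.IsDense (pcomp f g).domain := fun m => by
  refine F.mem_of_colon_mem (hg m) fun a ha => ?_
  refine F.mem_of_le (hf (g ⟨_, ha⟩)) fun b hb => ?_
  rw [mem_rightColon] at hb ⊢
  have key : MulOpposite.op b • MulOpposite.op a • m ∈ (pcomp f g).domain :=
    mem_pcomp.2 ⟨g.domain.smul_mem _ ha, by
      have := LinearPMap.map_smul g (MulOpposite.op b) ⟨_, ha⟩
      rw [← this] at hb
      exact hb⟩
  rw [← mul_smul] at key
  exact key

instance : Zero (PartialEnd F M) := ⟨⟨0, isDense_top⟩⟩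
instance : One (PartialEnd F M) := ⟨⟨(LinearMap.id : M →ₗ[Aᵐᵒᵖ] M).toPMap ⊤, isDense_top⟩⟩
instance : Add (PartialEnd F M) := ⟨fun f g => ⟨f.1 + g.1, f.2.inf g.2⟩⟩
instance : Neg (PartialEnd F M) := ⟨fun f => ⟨-f.1, f.2⟩⟩
instance : Mul (PartialEnd F M) := ⟨fun f g => ⟨pcomp f.1 g.1, isDense_pcomp f.2 g.2⟩⟩

theorem PartialEnd.locus_of_agree (f g : PartialEnd F M)
    (h : ∀ x (hf : x ∈ f.1.domain) (hg : x ∈ g.1.domain), f.1 ⟨x, hf⟩ = g.1 ⟨x, hg⟩) :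
    F.IsDense (f.1.eqLocus g.1) :=
  (f.2.inf g.2).mono fun x hx => ⟨hx.1, hx.2, h x hx.1 hx.2⟩

variable (F M)

/-- Two partial endomorphisms are identified when they agree on a dense submodule. -/
def denseSetoid : Setoid (PartialEnd F M) where
  r f g := F.IsDense (f.1.eqLocus g.1)
  iseqv :=
    { refl := fun f => PartialEnd.locus_of_agree f f fun _ _ _ => rfl
      symm := fun h => h.mono fun _ ⟨hf, hg, e⟩ => ⟨hg, hf, e.symm⟩
      trans := fun h h' => (h.inf h').mono fun _ ⟨⟨hf, _, e⟩, ⟨_, hk, e'⟩⟩ =>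
        ⟨hf, hk, e.trans e'⟩ }

/-- The direct limit of the groups `Hom_A(D, M)` over the dense submodules `D` of `M`, whose
elements multiply by composition. -/
def DenseEnd : Type v := Quotient (denseSetoid F M)

variable {F M}

/-- The class of a partial endomorphism with dense domain. -/
def DenseEnd.mk (f : PartialEnd F M) : DenseEnd F M := Quotient.mk (denseSetoid F M) f

theorem DenseEnd.mk_eq_mk {f g : PartialEnd F M} :
    DenseEnd.mk f = DenseEnd.mk g ↔ F.IsDense (f.1.eqLocus g.1) :=
  Quotient.eq (r := denseSetoid F M)

theorem DenseEnd.mk_eq_of_agree {f g : PartialEnd F M}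
    (h : ∀ x (hf : x ∈ f.1.domain) (hg : x ∈ g.1.domain), f.1 ⟨x, hf⟩ = g.1 ⟨x, hg⟩) :
    DenseEnd.mk f = DenseEnd.mk g :=
  DenseEnd.mk_eq_mk.2 (PartialEnd.locus_of_agree f g h)

instance : Zero (DenseEnd F M) := ⟨DenseEnd.mk 0⟩
instance : One (DenseEnd F M) := ⟨DenseEnd.mk 1⟩

instance : Neg (DenseEnd F M) :=
  ⟨Quotient.map' (fun f => -f) fun _ _ h => IsDense.mono h fun _ ⟨hf, hg, e⟩ =>
    ⟨hf, hg, congrArg Neg.neg e⟩⟩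

instance : Add (DenseEnd F M) :=
  ⟨Quotient.map₂ (· + ·) fun _ _ h _ _ h' => (IsDense.inf h h').mono
    fun _ ⟨⟨hf, hg, e⟩, ⟨hf', hg', e'⟩⟩ =>
      ⟨⟨hf, hf'⟩, ⟨hg, hg'⟩, congrArg₂ (· + ·) e e'⟩⟩

instance : Mul (DenseEnd F M) :=
  ⟨Quotient.map₂ (· * ·) fun f₁ f₂ h g₁ g₂ h' => by
    -- restrict `g₁` to the locus where it agrees with `g₂`, and `f₁` to that with `f₂`
    let G := g₁.1.domRestrict (g₁.1.eqLocus g₂.1)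
    let H := f₁.1.domRestrict (f₁.1.eqLocus f₂.1)
    have hG : F.IsDense G.domain := (IsDense.inf h' g₁.2)
    have hH : F.IsDense H.domain := (IsDense.inf h f₁.2)
    refine (isDense_pcomp hH hG).mono fun x hx => ?_
    obtain ⟨⟨⟨k₁, k₂, e⟩, _⟩, hx₂⟩ := mem_pcomp.1 hx
    obtain ⟨⟨l₁, l₂, e'⟩, _⟩ := hx₂
    have e₀ : g₁.1 ⟨x, k₁⟩ = g₂.1 ⟨x, k₂⟩ := e
    refine ⟨mem_pcomp.2 ⟨k₁, l₁⟩, mem_pcomp.2 ⟨k₂, e₀ ▸ l₂⟩, ?_⟩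
    refine Eq.trans (e' : f₁.1 ⟨g₁.1 ⟨x, k₁⟩, l₁⟩ = f₂.1 ⟨g₁.1 ⟨x, k₁⟩, l₂⟩) ?_
    change f₂.1 _ = f₂.1 _
    congr 1
    exact Subtype.ext e₀⟩

instance : Ring (DenseEnd F M) where
  add_assoc := by
    rintro ⟨f⟩ ⟨g⟩ ⟨h⟩
    exact DenseEnd.mk_eq_of_agree fun x _ _ => add_assoc _ _ _
  zero_add := by
    rintro ⟨f⟩
    exact DenseEnd.mk_eq_of_agree fun x _ _ => zero_add _
  add_zero := by
    rintro ⟨f⟩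
    exact DenseEnd.mk_eq_of_agree fun x _ _ => add_zero _
  add_comm := by
    rintro ⟨f⟩ ⟨g⟩
    exact DenseEnd.mk_eq_of_agree fun x _ _ => add_comm _ _
  neg_add_cancel := by
    rintro ⟨f⟩
    exact DenseEnd.mk_eq_of_agree fun x _ _ => neg_add_cancel _
  zero_mul := by
    rintro ⟨f⟩
    exact DenseEnd.mk_eq_of_agree fun x _ _ => rfl
  mul_zero := by
    rintro ⟨f⟩
    exact DenseEnd.mk_eq_of_agree fun x _ _ => LinearPMap.map_zero f.1
  one_mul := by
    rintro ⟨f⟩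
    exact DenseEnd.mk_eq_of_agree fun x _ _ => rfl
  mul_one := by
    rintro ⟨f⟩
    exact DenseEnd.mk_eq_of_agree fun x _ _ => rfl
  mul_assoc := by
    rintro ⟨f⟩ ⟨g⟩ ⟨h⟩
    exact DenseEnd.mk_eq_of_agree fun x _ _ => rfl
  left_distrib := by
    rintro ⟨f⟩ ⟨g⟩ ⟨h⟩
    exact DenseEnd.mk_eq_of_agree fun x hx hy => by
      obtain ⟨h₁, h₂⟩ := hy
      obtain ⟨a₁, b₁⟩ := mem_pcomp.1 h₁
      obtain ⟨a₂, b₂⟩ := mem_pcomp.1 h₂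
      exact LinearPMap.map_add f.1 ⟨g.1 ⟨x, a₁⟩, b₁⟩ ⟨h.1 ⟨x, a₂⟩, b₂⟩
  right_distrib := by
    rintro ⟨f⟩ ⟨g⟩ ⟨h⟩
    exact DenseEnd.mk_eq_of_agree fun x _ _ => rfl
  nsmul := nsmulRec
  zsmul := zsmulRec

variable (F M)

/-- Everywhere defined endomorphisms, viewed as elements of `DenseEnd F M`. -/
def endToDenseEnd : Module.End Aᵐᵒᵖ M →+* DenseEnd F M where
  toFun f := DenseEnd.mk ⟨LinearMap.toPMap f ⊤, isDense_top⟩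
  map_one' := rfl
  map_zero' := DenseEnd.mk_eq_of_agree fun _ _ _ => rfl
  map_mul' _ _ := DenseEnd.mk_eq_of_agree fun _ _ _ => rfl
  map_add' _ _ := DenseEnd.mk_eq_of_agree fun _ _ _ => rfl

end DenseEnd

/-! ### The ring of right quotients -/

/-- The torsion submodule `t(A)` of the right module `A`. -/
def torsion : RightIdeal A where
  carrier := {a | rightColon (⊥ : RightIdeal A) a ∈ F.sets}
  add_mem' {a b} ha hb := F.mem_of_le (F.inf_mem ha hb) fun c hc => by
    have h₁ := hc.1
    have h₂ := hc.2
    simp only [mem_rightColon, SetLike.mem_coe, Submodule.mem_bot, smul_add] at *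
    rw [h₁, h₂, add_zero]
  zero_mem' := F.mem_of_le F.top_mem fun c _ => by simp [mem_rightColon]
  smul_mem' c a ha := by
    refine F.mem_of_le (F.colon_mem ha c.unop) fun b hb => ?_
    simp only [mem_rightColon, Submodule.mem_bot, MulOpposite.smul_eq_mul_unop] at *
    simpa [mul_assoc] using hb

theorem torsion_le_comap (a : A) :
    F.torsion ≤ F.torsion.comap (DistribSMul.toLinearMap Aᵐᵒᵖ A a) := fun b hb => by
  refine F.mem_of_le (R := rightColon ⊥ b) hb fun c hc => ?_
  simp only [mem_rightColon, Submodule.mem_bot, op_smul_eq_mul,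
    DistribSMul.toLinearMap_apply, smul_eq_mul] at *
  rw [mul_assoc, hc, mul_zero]

/-- Left multiplication of `A` on the right module `A ⧸ t(A)`. -/
def leftMul : A →+* Module.End Aᵐᵒᵖ (A ⧸ F.torsion) where
  toFun a := F.torsion.mapQ F.torsion (DistribSMul.toLinearMap Aᵐᵒᵖ A a) (F.torsion_le_comap a)
  map_one' := by ext; simp
  map_zero' := by ext; simp
  map_mul' a b := by
    ext
    simp
  map_add' a b := by
    ext
    simp

/-- The ring `A_F` of right quotients of `A` with respect to `F`: the direct limit of
`Hom_A(R, A ⧸ t(A))` over the open right ideals `R`. As such a homomorphism kills `R ∩ t(A)`,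
it is the same thing as a homomorphism to `A ⧸ t(A)` from the image of `R` in `A ⧸ t(A)`, and
these images are cofinal among the dense submodules; in this form the product is composition. -/
def RingOfQuotients : Type u := DenseEnd F (A ⧸ F.torsion)

instance : Ring F.RingOfQuotients := inferInstanceAs (Ring (DenseEnd F (A ⧸ F.torsion)))

/-- The canonical homomorphism `A → A_F`, sending `a` to left multiplication by `a`. -/
def toRingOfQuotients : A →+* F.RingOfQuotients :=
  (endToDenseEnd F (A ⧸ F.torsion)).comp F.leftMul

/-- If `A` is a `K`-algebra, then so is `A_F`. -/
instance {K : Type v} [Field K] [Algebra K A] : Algebra K F.RingOfQuotients :=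
  (F.toRingOfQuotients.comp (algebraMap K A)).toAlgebra' <| by
    rintro k ⟨f⟩
    have hk : ∀ y : A ⧸ F.torsion, F.leftMul (algebraMap K A k) y =
        MulOpposite.op (algebraMap K A k) • y := by
      intro y
      obtain ⟨a, rfl⟩ := Submodule.Quotient.mk_surjective _ y
      change Submodule.Quotient.mk (algebraMap K A k * a) =
        Submodule.Quotient.mk (a * algebraMap K A k)
      rw [Algebra.commutes]
    refine DenseEnd.mk_eq_of_agree fun x hx hy => ?_
    obtain ⟨h₁, -⟩ := mem_pcomp.1 hx
    obtain ⟨h₂, h₃⟩ := mem_pcomp.1 hy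
    change F.leftMul (algebraMap K A k) (f.1 ⟨x, h₁⟩) =
      f.1 ⟨F.leftMul (algebraMap K A k) x, h₃⟩
    rw [hk, ← LinearPMap.map_smul]
    congr 1
    exact Subtype.ext (hk x).symm

end GabrielTopology

/-! ### Flat bimorphisms and the families of right ideals they induce -/

section Flat

variable (A : Type u) [Ring A]

/-- The tensor product `N ⊗_A M` of a right module and a left module over a not necessarily
commutative ring. -/
def BalancedTensor (N : Type*) [AddCommGroup N] [Module Aᵐᵒᵖ N]
    (M : Type*) [AddCommGroup M] [Module A M] :=
  (N ⊗[ℤ] M) ⧸ AddSubgroup.closure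
    {t : N ⊗[ℤ] M | ∃ (n : N) (a : A) (m : M),
      t = (MulOpposite.op a • n) ⊗ₜ[ℤ] m - n ⊗ₜ[ℤ] (a • m)}

instance (N : Type*) [AddCommGroup N] [Module Aᵐᵒᵖ N] (M : Type*) [AddCommGroup M] [Module A M] :
    AddCommGroup (BalancedTensor A N M) :=
  inferInstanceAs (AddCommGroup ((N ⊗[ℤ] M) ⧸ AddSubgroup.closure _))

/-- The homomorphism `g ⊗ id_M : N ⊗_A M → N' ⊗_A M` induced by `g : N → N'`. -/
def BalancedTensor.map {N N' : Type*} [AddCommGroup N] [Module Aᵐᵒᵖ N] [AddCommGroup N']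
    [Module Aᵐᵒᵖ N'] (M : Type*) [AddCommGroup M] [Module A M] (g : N →ₗ[Aᵐᵒᵖ] N') :
    BalancedTensor A N M →+ BalancedTensor A N' M :=
  QuotientAddGroup.map _ _
    (TensorProduct.map g.toAddMonoidHom.toIntLinearMap LinearMap.id).toAddMonoidHom (by
      rw [AddSubgroup.closure_le]
      rintro _ ⟨n, a, m, rfl⟩
      refine AddSubgroup.subset_closure ⟨g n, a, m, ?_⟩
      simp)

/-- A left module `M` is flat if `- ⊗_A M` preserves injectivity of homomorphisms of right
modules. -/
def IsFlatLeftModule (M : Type v) [AddCommGroup M] [Module A M] : Prop :=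
  ∀ (N N' : Type u) [AddCommGroup N] [Module Aᵐᵒᵖ N] [AddCommGroup N'] [Module Aᵐᵒᵖ N']
    (g : N →ₗ[Aᵐᵒᵖ] N'), Function.Injective g → Function.Injective (BalancedTensor.map A M g)

end Flat

/-- A ring homomorphism `φ : A → B` is a flat bimorphism if it is both a monomorphism and an
epimorphism in the category of rings and `B` is flat as a left `A`-module via `φ`. -/
structure IsFlatBimorphism {A B : Type u} [Ring A] [Ring B] (φ : A →+* B) : Prop where
  mono : CategoryTheory.Mono (RingCat.ofHom φ)
  epi : CategoryTheory.Epi (RingCat.ofHom φ)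
  flat : letI := Module.compHom B φ; IsFlatLeftModule A B

/-- The family of right ideals `R` of `A` with `φ(R) B = B`. -/
def inducedTopology {A B : Type u} [Ring A] [Ring B] (φ : A →+* B) : Set (RightIdeal A) :=
  {R | Submodule.span Bᵐᵒᵖ (φ '' (R : Set A)) = ⊤}

/-- The family of the right ideals of the `K`-algebra `A` that contain some power of the right
ideal `I`; a power of `I` is the `K`-span of the products of elements of `I`. -/
def idealTopology (K : Type u) {A : Type u} [Field K] [Ring A] [Algebra K A] (I : RightIdeal A) :
    Set (RightIdeal A) :=
  {R | ∃ l : ℕ, (I.restrictScalars K) ^ l ≤ R.restrictScalars K}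

/-! ### Leavitt algebras -/

section Leavitt

variable (K : Type u) [Field K] (n : ℕ)

/-- The generators of the Leavitt algebra: `Sum.inl i` stands for `a i`, and `Sum.inr i` for its
formal adjoint. -/
abbrev leavittGen (x : Fin n ⊕ Fin n) : FreeAlgebra K (Fin n ⊕ Fin n) := FreeAlgebra.ι K x

/-- The relations `a_j^* a_i = δ_{ij}` and `∑ a_i a_i^* = 1`. -/
inductive LeavittRel : FreeAlgebra K (Fin n ⊕ Fin n) → FreeAlgebra K (Fin n ⊕ Fin n) → Prop
  | star_mul (i j : Fin n) :
      LeavittRel (leavittGen K n (Sum.inr j) * leavittGen K n (Sum.inl i)) (if j = i then 1 else 0)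
  | sum_mul_star :
      LeavittRel (∑ i, leavittGen K n (Sum.inl i) * leavittGen K n (Sum.inr i)) 1

/-- The Leavitt algebra `L_K(1, n)`. -/
abbrev LeavittAlgebra : Type u := RingQuot (LeavittRel K n)

/-- The generator `a_i` of the Leavitt algebra. -/
def LeavittAlgebra.a (i : Fin n) : LeavittAlgebra K n :=
  RingQuot.mkAlgHom K (LeavittRel K n) (leavittGen K n (Sum.inl i))

end Leavitt

/-! Call `φ : A → B` a perfect localization at `F` if it is injective, every `b` satisfies `b φ(R) ⊆
φ(A)` for some open `R`, and `φ(R) B = B` for every open `R`. Such a map is always a flat bimorphism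
inducing `F` (`isFlatBimorphism`, `sets_eq_inducedTopology`), so both claims reduce to showing that
`A → A_F` is one.

Let `I` be a two-sided ideal of finite codimension in the free algebra. Fox derivatives twisted by
the representation on `A ⧸ I` give `I` a finite dual basis `y_j`, `f_j` as a right ideal
(`exists_dualBasis`). Hence `I` is finitely generated, which makes its ideal topology Gabriel
(`ofIdeal`). The topology has no torsion, because `A` is a domain and no power of `I` is zero.
Finally, the `f_j` are elements of `A_F` with `∑ y_j f_j = 1`, so `I A_F = A_F`, and the same
follows for all powers of `I`.

A right ideal of codimension one is automatically two-sided, since every `a` is a scalar modulo `I`.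
It is free on the `x_i - c_i`; these elements and their coordinate functions satisfy the Leavitt
relations in `A_F`. The resulting map `L_K(1,n) → A_F` over `A` is bijective, because the Leavitt
algebra has open denominators too (`bijective_of_comp_eq`). -/

namespace GabrielTopology

variable {A : Type u} [Ring A] (F : GabrielTopology A)

/-! ### Perfect localizations and the condition `φ(R) B = B` -/

/-- The filter on `A` generated by the open right ideals. -/
def openFilter : Filter A where
  sets := {s | ∃ R ∈ F.sets, (R : Set A) ⊆ s}
  univ_sets := ⟨⊤, F.top_mem, Set.subset_univ _⟩
  sets_of_superset := fun ⟨R, hR, h⟩ h' => ⟨R, hR, h.trans h'⟩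
  inter_sets := fun ⟨R, hR, h⟩ ⟨S, hS, h'⟩ =>
    ⟨R ⊓ S, F.inf_mem hR hS, fun _ hx => ⟨h hx.1, h' hx.2⟩⟩

variable {F} in
theorem eventually_openFilter {p : A → Prop} :
    (∀ᶠ a in F.openFilter, p a) ↔ ∃ R ∈ F.sets, ∀ a ∈ R, p a := Iff.rfl

/-- A ring homomorphism `φ : A → B` exhibits `B` as a perfect localization of `A` at `F`. -/
structure IsPerfectLocalization {B : Type u} [Ring B] (φ : A →+* B) : Prop where
  injective : Function.Injective φ
  exists_mul_mem : ∀ b : B, ∃ R ∈ F.sets, ∀ r ∈ R, b * φ r ∈ φ.range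
  span_eq_top : ∀ R ∈ F.sets, Submodule.span Bᵐᵒᵖ (φ '' (R : Set A)) = ⊤

end GabrielTopology

theorem exists_sum_mul_eq_one_of_mem_inducedTopology {A B : Type u} [Ring A] [Ring B] {φ : A →+* B}
    {R : RightIdeal A} (hR : R ∈ inducedTopology φ) :
    ∃ (m : ℕ) (r : Fin m → A) (c : Fin m → B), (∀ j, r j ∈ R) ∧ ∑ j, φ (r j) * c j = 1 := by
  have h1 : (1 : B) ∈ Submodule.span Bᵐᵒᵖ (φ '' (R : Set A)) := by
    rw [show Submodule.span Bᵐᵒᵖ (φ '' (R : Set A)) = ⊤ from hR]; trivial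
  obtain ⟨m, f, g, h⟩ := Submodule.mem_span_set'.1 h1
  choose r hr hr' using fun j => (g j).2
  refine ⟨m, r, fun j => (f j).unop, hr, ?_⟩
  simpa [hr', MulOpposite.smul_eq_mul_unop] using h

theorem mem_inducedTopology_of_sum_mul_eq_one {A B : Type u} [Ring A] [Ring B] {φ : A →+* B}
    {R : RightIdeal A} {ι : Type*} {s : Finset ι} {r : ι → A} {c : ι → B} (hr : ∀ j ∈ s, r j ∈ R)
    (h : ∑ j ∈ s, φ (r j) * c j = 1) : R ∈ inducedTopology φ := by
  have h1 : (1 : B) ∈ Submodule.span Bᵐᵒᵖ (φ '' (R : Set A)) := by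
    rw [← h]
    exact Submodule.sum_mem _ fun j hj =>
      Submodule.smul_mem _ (MulOpposite.op (c j)) (Submodule.subset_span ⟨_, hr j hj, rfl⟩)
  refine eq_top_iff.2 fun b _ => ?_
  simpa using Submodule.smul_mem _ (MulOpposite.op b) h1

/-! ### Balanced tensor products -/

namespace BalancedTensor

variable {A : Type u} [Ring A] {N : Type*} [AddCommGroup N] [Module Aᵐᵒᵖ N]
  {M : Type*} [AddCommGroup M] [Module A M]

/-- The projection from the tensor product over `ℤ`. -/
def proj : N ⊗[ℤ] M →+ BalancedTensor A N M := QuotientAddGroup.mk' _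

/-- The pure tensors. -/
def tmul (n : N) (m : M) : BalancedTensor A N M := proj (n ⊗ₜ[ℤ] m)

theorem add_tmul (n n' : N) (m : M) :
    (tmul (n + n') m : BalancedTensor A N M) = tmul n m + tmul n' m := by
  simp [tmul, TensorProduct.add_tmul]

theorem tmul_add (n : N) (m m' : M) :
    (tmul n (m + m') : BalancedTensor A N M) = tmul n m + tmul n m' := by
  simp [tmul, TensorProduct.tmul_add]

theorem zero_tmul (m : M) : (tmul (0 : N) m : BalancedTensor A N M) = 0 := by
  simp [tmul]

theorem tmul_sum (n : N) {ι : Type*} (s : Finset ι) (m : ι → M) :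
    (tmul n (∑ i ∈ s, m i) : BalancedTensor A N M) = ∑ i ∈ s, tmul n (m i) := by
  simp [tmul, TensorProduct.tmul_sum]

theorem smul_tmul (n : N) (a : A) (m : M) :
    (tmul (MulOpposite.op a • n) m : BalancedTensor A N M) = tmul n (a • m) :=
  sub_eq_zero.1 <| by
    rw [tmul, tmul, ← map_sub]
    exact (QuotientAddGroup.eq_zero_iff _).2 (AddSubgroup.subset_closure ⟨n, a, m, rfl⟩)

theorem induction_on {p : BalancedTensor A N M → Prop} (t : BalancedTensor A N M)
    (zero : p 0) (tmul : ∀ n m, p (tmul n m)) (add : ∀ x y, p x → p y → p (x + y)) : p t := by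
  obtain ⟨t, rfl⟩ := QuotientAddGroup.mk_surjective t
  induction t using TensorProduct.induction_on with
  | zero => exact zero
  | tmul n m => exact tmul n m
  | add x y hx hy => exact add _ _ hx hy

/-- The universal property of the balanced tensor product. -/
def lift {P : Type*} [AddCommGroup P] (f : N →+ M →+ P)
    (hf : ∀ (n : N) (a : A) (m : M), f (MulOpposite.op a • n) m = f n (a • m)) : BalancedTensor A N M →+ P :=
  QuotientAddGroup.lift _ (TensorProduct.liftAddHom (R := ℤ) f (by simp)) (by
    rw [AddSubgroup.closure_le]
    rintro _ ⟨n, a, m, rfl⟩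
    simp [AddMonoidHom.mem_ker, hf])

theorem map_tmul {N' : Type*} [AddCommGroup N'] [Module Aᵐᵒᵖ N'] (g : N →ₗ[Aᵐᵒᵖ] N') (n : N)
    (m : M) : BalancedTensor.map A M g (tmul n m) = tmul (g n) m := rfl

end BalancedTensor

/-! ### Perfect localizations are flat bimorphisms and induce the topology -/

namespace GabrielTopology.IsPerfectLocalization

variable {A B : Type u} [Ring A] [Ring B] {F : GabrielTopology A} {φ : A →+* B}

open Classical in
/-- The element `a` with `b φ(s) = φ(a)`, if there is one. -/
noncomputable def numerator (φ : A →+* B) (b : B) (s : A) : A :=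
  -- The default `0` is invisible to germs: for fixed `b`, all `s` in some open right ideal fall
  -- under the first case.
  if h : ∃ a, φ a = b * φ s then h.choose else 0

theorem map_numerator {b : B} {s : A} (h : b * φ s ∈ φ.range) :
    φ (numerator φ b s) = b * φ s := by
  have h' : ∃ a, φ a = b * φ s := h
  rw [numerator, dif_pos h']
  exact h'.choose_spec

theorem eventually_map_numerator (hφ : F.IsPerfectLocalization φ) (b : B) :
    ∀ᶠ s in F.openFilter, φ (numerator φ b s) = b * φ s := by
  obtain ⟨R, hR, h⟩ := hφ.exists_mul_mem b
  exact eventually_openFilter.2 ⟨R, hR, fun r hr => map_numerator (h r hr)⟩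

section

variable (hφ : F.IsPerfectLocalization φ) [Module A B] (hB : ∀ (a : A) (b : B), a • b = φ a * b)
  {N : Type*} [AddCommGroup N] [Module Aᵐᵒᵖ N]

/-- The homomorphism from `N ⊗ B` to germs of maps `A → N` along the open right ideals, sending
`n ⊗ b` to the germ of `s ↦ n (b s)`. -/
noncomputable def toGerm : BalancedTensor A N B →+ F.openFilter.Germ N :=
  BalancedTensor.lift
    (AddMonoidHom.mk' (fun n => AddMonoidHom.mk'
        (fun b => ((fun s => MulOpposite.op (numerator φ b s) • n : A → N) : F.openFilter.Germ N))
        fun b b' => by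
          refine Filter.Germ.coe_eq.2 ?_
          filter_upwards [hφ.eventually_map_numerator b, hφ.eventually_map_numerator b',
            hφ.eventually_map_numerator (b + b')] with s h h' h''
          have : numerator φ (b + b') s = numerator φ b s + numerator φ b' s :=
            hφ.injective (by rw [map_add, h, h', h'', add_mul])
          simp [this, add_smul])
      fun n n' => by
        ext b
        refine Filter.Germ.coe_eq.2 (.of_forall fun s => ?_)
        simp)
    fun n a b => by
      refine Filter.Germ.coe_eq.2 ?_
      filter_upwards [hφ.eventually_map_numerator b,
        hφ.eventually_map_numerator (a • b)] with s h h'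
      have : numerator φ (a • b) s = a * numerator φ b s :=
        hφ.injective (by rw [map_mul, h, h', hB, mul_assoc])
      simp [this, mul_smul]

theorem toGerm_tmul (n : N) (b : B) : toGerm hφ hB (.tmul n b) =
    ((fun s => MulOpposite.op (numerator φ b s) • n : A → N) : F.openFilter.Germ N) := rfl

/-- The germ of `t` determines `t`, since `n ⊗ b = ∑ n ⊗ b φ(r_j) c_j = ∑ n (b r_j) ⊗ c_j`. The
representative `h` and the bound `R` do not depend on the family `r`, so the `r_j` may later be
taken in a smaller open right ideal. -/
theorem exists_toGerm_eq (t : BalancedTensor A N B) :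
    ∃ h : A → N, toGerm hφ hB t = (h : F.openFilter.Germ N) ∧ ∃ R ∈ F.sets,
      ∀ (m : ℕ) (r : Fin m → A) (c : Fin m → B), (∀ j, r j ∈ R) → ∑ j, φ (r j) * c j = 1 →
        t = ∑ j, .tmul (h (r j)) (c j) := by
  induction t using BalancedTensor.induction_on with
  | zero =>
    exact ⟨0, map_zero _, ⊤, F.top_mem, fun m r c _ _ => by simp [BalancedTensor.zero_tmul]⟩
  | tmul n b =>
    obtain ⟨R, hR, hb⟩ := hφ.exists_mul_mem b
    refine ⟨_, toGerm_tmul hφ hB n b, R, hR, fun m r c hr h => ?_⟩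
    calc BalancedTensor.tmul n b = .tmul n (∑ j, numerator φ b (r j) • c j) := by
          congr 1
          conv_lhs => rw [← mul_one b, ← h, Finset.mul_sum]
          refine Finset.sum_congr rfl fun j _ => ?_
          rw [hB, map_numerator (hb _ (hr j)), mul_assoc]
      _ = _ := by simp_rw [BalancedTensor.tmul_sum, BalancedTensor.smul_tmul]
  | add x y hx hy =>
    obtain ⟨f, hf, R, hR, hx⟩ := hx
    obtain ⟨g, hg, S, hS, hy⟩ := hy
    refine ⟨f + g, by rw [map_add, hf, hg]; rfl, R ⊓ S, F.inf_mem hR hS, fun m r c hr h => ?_⟩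
    conv_lhs => rw [hx m r c (fun j => (hr j).1) h, hy m r c (fun j => (hr j).2) h]
    simp [BalancedTensor.add_tmul, Finset.sum_add_distrib]

/-- If the germ vanishes, choose the `r_j` in an open right ideal on which the representative is
zero; then every summand of the recovery formula is zero. -/
theorem toGerm_injective :
    Function.Injective (toGerm hφ hB : BalancedTensor A N B →+ F.openFilter.Germ N) := by
  refine (injective_iff_map_eq_zero _).2 fun t ht => ?_
  obtain ⟨h, hh, R, hR, H⟩ := exists_toGerm_eq hφ hB t
  have h0 : ∀ᶠ s in F.openFilter, h s = 0 := Filter.Germ.coe_eq.1 (hh.symm.trans ht)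
  obtain ⟨S, hS, h0⟩ := eventually_openFilter.1 h0
  obtain ⟨m, r, c, hr, h1⟩ := exists_sum_mul_eq_one_of_mem_inducedTopology
    (hφ.span_eq_top _ (F.inf_mem hR hS))
  rw [H m r c (fun j => (hr j).1) h1]
  exact Finset.sum_eq_zero fun j _ => by rw [h0 _ (hr j).2, BalancedTensor.zero_tmul]

theorem toGerm_map {N' : Type*} [AddCommGroup N'] [Module Aᵐᵒᵖ N'] (g : N →ₗ[Aᵐᵒᵖ] N')
    (t : BalancedTensor A N B) :
    toGerm hφ hB (BalancedTensor.map A B g t) = (toGerm hφ hB t).map g := by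
  induction t using BalancedTensor.induction_on with
  | zero =>
    rw [map_zero, map_zero, map_zero]
    exact Filter.Germ.coe_eq.2 (.of_forall fun s => (map_zero g).symm)
  | tmul n b =>
    rw [BalancedTensor.map_tmul, toGerm_tmul, toGerm_tmul]
    refine Filter.Germ.coe_eq.2 (.of_forall fun s => ?_)
    simp
  | add x y hx hy =>
    rw [map_add, map_add, map_add, hx, hy]
    generalize toGerm hφ hB x = p
    generalize toGerm hφ hB y = q
    induction p using Filter.Germ.inductionOn with | _ p
    induction q using Filter.Germ.inductionOn with | _ q
    exact Filter.Germ.coe_eq.2 (.of_forall fun s => (map_add g (p s) (q s)).symm)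

-- Composition with an injective map is injective on germs, and `N ⊗ B` embeds into germs naturally
-- in `N`.
include hφ hB in
theorem isFlatLeftModule : IsFlatLeftModule A B := by
  intro N N' _ _ _ _ g hg x y hxy
  apply toGerm_injective hφ hB
  have h := congrArg (toGerm hφ hB) hxy
  rw [toGerm_map, toGerm_map] at h
  generalize toGerm hφ hB x = p at h ⊢
  generalize toGerm hφ hB y = q at h ⊢
  induction p using Filter.Germ.inductionOn with | _ p
  induction q using Filter.Germ.inductionOn with | _ q
  refine Filter.Germ.coe_eq.2 ?_
  filter_upwards [Filter.Germ.coe_eq.1 h] with s hs using hg hs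

end

/-- Write `1 = ∑ φ(r_j) d_j` with `r_j ∈ R` and multiply by `c`. The general target `C` is what the
epimorphism property needs. -/
theorem eq_zero_of_mul_eq_zero (hφ : F.IsPerfectLocalization φ) {C : Type*} [Ring C] (f : B →+* C)
    {c : C} {R : RightIdeal A} (hR : R ∈ F.sets) (h : ∀ r ∈ R, c * f (φ r) = 0) : c = 0 := by
  obtain ⟨m, r, d, hr, h1⟩ := exists_sum_mul_eq_one_of_mem_inducedTopology (hφ.span_eq_top R hR)
  rw [← mul_one c, ← map_one f, ← h1, map_sum, Finset.mul_sum]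
  exact Finset.sum_eq_zero fun j _ => by rw [map_mul, ← mul_assoc, h _ (hr j), zero_mul]

/-- If `b φ(r) = φ(a)`, then `f(b)` and `g(b)` agree after multiplication by the common value
`f(φ(r)) = g(φ(r))`; open right ideals can be cancelled. -/
theorem hom_ext (hφ : F.IsPerfectLocalization φ) {C : Type*} [Ring C] {f g : B →+* C}
    (h : f.comp φ = g.comp φ) : f = g := by
  ext b
  obtain ⟨R, hR, hb⟩ := hφ.exists_mul_mem b
  refine sub_eq_zero.1 (hφ.eq_zero_of_mul_eq_zero f hR fun r hr => ?_)
  obtain ⟨a, ha⟩ := hb r hr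
  have h' : ∀ a, f (φ a) = g (φ a) := RingHom.congr_fun h
  rw [sub_mul, ← map_mul, ← ha, h', h', ← map_mul, ha, sub_self]

theorem isFlatBimorphism (hφ : F.IsPerfectLocalization φ) : IsFlatBimorphism φ where
  mono := CategoryTheory.ConcreteCategory.mono_of_injective _ hφ.injective
  epi := ⟨fun _ _ h => RingCat.hom_ext (hφ.hom_ext (congrArg RingCat.Hom.hom h))⟩
  flat :=
    letI := Module.compHom B φ
    hφ.isFlatLeftModule fun _ _ => rfl

theorem sets_eq_inducedTopology (hφ : F.IsPerfectLocalization φ) :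
    F.sets = inducedTopology φ := by
  refine Set.Subset.antisymm hφ.span_eq_top fun R hR => ?_
  obtain ⟨m, r, c, hr, h1⟩ := exists_sum_mul_eq_one_of_mem_inducedTopology hR
  -- A common denominator ideal `S` for the finitely many `c_j` lies in `R`: for `s ∈ S`, `s = ∑ r_j
  -- (c_j s)` with `c_j s ∈ A`.
  have h : ∀ᶠ s in F.openFilter, ∀ j, φ (numerator φ (c j) s) = c j * φ s :=
    Filter.eventually_all.2 fun j => hφ.eventually_map_numerator (c j)
  obtain ⟨S, hS, h⟩ := eventually_openFilter.1 h
  refine F.mem_of_le hS fun s hs => ?_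
  have : s = ∑ j, r j * numerator φ (c j) s := hφ.injective <| by
    simp_rw [map_sum, map_mul, h s hs, ← mul_assoc, ← Finset.sum_mul, h1, one_mul]
  rw [this]
  exact R.sum_mem fun j _ => R.smul_mem (MulOpposite.op (numerator φ (c j) s)) (hr j)

theorem comp_ringEquiv (hφ : F.IsPerfectLocalization φ) {C : Type u} [Ring C] (e : B ≃+* C) :
    F.IsPerfectLocalization ((e : B →+* C).comp φ) where
  injective := e.injective.comp hφ.injective
  exists_mul_mem c := by
    obtain ⟨R, hR, h⟩ := hφ.exists_mul_mem (e.symm c)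
    refine ⟨R, hR, fun r hr => ?_⟩
    obtain ⟨a, ha⟩ := h r hr
    exact ⟨a, by simp [ha]⟩
  span_eq_top R hR := by
    obtain ⟨m, r, c, hr, h1⟩ := exists_sum_mul_eq_one_of_mem_inducedTopology (hφ.span_eq_top R hR)
    refine mem_inducedTopology_of_sum_mul_eq_one (s := Finset.univ) (c := fun j => e (c j))
      (fun j _ => hr j) ?_
    simpa using congrArg e h1

/-- A homomorphism over `A` from a ring in which the open right ideals generate the unit ideal and
whose elements have open denominators to a perfect localization is bijective. -/
theorem bijective_of_comp_eq (hφ : F.IsPerfectLocalization φ) {C : Type u} [Ring C] {ψ : A →+* C}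
    (θ : C →+* B) (hθ : θ.comp ψ = φ)
    (hψ : ∀ c : C, ∃ R ∈ F.sets, ∀ r ∈ R, c * ψ r ∈ ψ.range)
    (hψ' : ∀ R ∈ F.sets, R ∈ inducedTopology ψ) : Function.Bijective θ := by
  have hθ' : ∀ a, θ (ψ a) = φ a := RingHom.congr_fun hθ
  -- Injectivity of `ψ` is inherited from `φ`, so `ψ` is itself a perfect localization.
  have hψ_perf : F.IsPerfectLocalization ψ :=
    ⟨fun a b h => hφ.injective (by rw [← hθ', h, hθ']), hψ, hψ'⟩
  refine ⟨(injective_iff_map_eq_zero θ).2 fun c hc => ?_, fun b => ?_⟩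
  · obtain ⟨R, hR, h⟩ := hψ c
    refine hψ_perf.eq_zero_of_mul_eq_zero (RingHom.id C) hR fun r hr => ?_
    obtain ⟨a, ha⟩ := h r hr
    have : φ a = 0 := by rw [← hθ', ha, map_mul, hc, zero_mul]
    rw [RingHom.id_apply, ← ha, hφ.injective (this.trans (map_zero φ).symm), map_zero]
  -- Surjectivity: with `1 = ∑ ψ(r_j) c_j` and `r_j` in a denominator ideal of `b`, one has `b = ∑
  -- (b φ(r_j)) θ(c_j)`, and each `b φ(r_j)` comes from `A`.
  · obtain ⟨R, hR, h⟩ := hφ.exists_mul_mem b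
    obtain ⟨m, r, c, hr, h1⟩ := exists_sum_mul_eq_one_of_mem_inducedTopology (hψ' R hR)
    refine ⟨∑ j, ψ (numerator φ b (r j)) * c j, ?_⟩
    simp_rw [map_sum, map_mul, hθ', map_numerator (h _ (hr _)), mul_assoc, ← Finset.mul_sum,
      ← hθ', ← map_mul, ← map_sum, h1, map_one, mul_one]

end GabrielTopology.IsPerfectLocalization

/-! ### The ring of right quotients of a torsion-free ring -/

namespace GabrielTopology

variable {A : Type u} [Ring A] {F : GabrielTopology A}

/-- If `A` is torsion-free, then `A` is its own torsion-free quotient. -/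
noncomputable def quotTorsionEquiv (h : F.torsion = ⊥) : (A ⧸ F.torsion) ≃ₗ[Aᵐᵒᵖ] A :=
  F.torsion.quotEquivOfEqBot h

theorem quotTorsionEquiv_leftMul (h : F.torsion = ⊥) (a : A) (x : A ⧸ F.torsion) :
    quotTorsionEquiv h (F.leftMul a x) = a * quotTorsionEquiv h x := by
  obtain ⟨x, rfl⟩ := Submodule.Quotient.mk_surjective _ x
  rfl

theorem leftMul_quotTorsionEquiv_symm (h : F.torsion = ⊥) (a b : A) :
    F.leftMul a ((quotTorsionEquiv h).symm b) = (quotTorsionEquiv h).symm (a * b) := by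
  rw [LinearEquiv.eq_symm_apply, quotTorsionEquiv_leftMul, LinearEquiv.apply_symm_apply]

theorem isDense_comap_quotTorsionEquiv (h : F.torsion = ⊥) {R : RightIdeal A} (hR : R ∈ F.sets) :
    F.IsDense (R.comap (quotTorsionEquiv h).toLinearMap) := fun x => by
  refine F.mem_of_le (F.colon_mem hR (quotTorsionEquiv h x)) fun a ha => ?_
  rw [mem_rightColon] at ha ⊢
  simpa using ha

/-- The element of the ring of right quotients defined by a homomorphism from an open right
ideal. -/
noncomputable def ofHom (h : F.torsion = ⊥) {R : RightIdeal A} (hR : R ∈ F.sets)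
    (f : R →ₗ[Aᵐᵒᵖ] A) : F.RingOfQuotients :=
  DenseEnd.mk ⟨⟨R.comap (quotTorsionEquiv h).toLinearMap,
    (quotTorsionEquiv h).symm.toLinearMap ∘ₗ f ∘ₗ
      (quotTorsionEquiv h).toLinearMap.restrict fun _ hx => hx⟩,
    isDense_comap_quotTorsionEquiv h hR⟩

/-- Right linearity, `f(r x) = f(r) x`, says that `f` composed with left multiplication by `r` is
left multiplication by `f(r)`. -/
theorem ofHom_mul (h : F.torsion = ⊥) {R : RightIdeal A} (hR : R ∈ F.sets)
    (f : R →ₗ[Aᵐᵒᵖ] A) (r : A) (hr : r ∈ R) :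
    ofHom h hR f * F.toRingOfQuotients r = F.toRingOfQuotients (f ⟨r, hr⟩) := by
  refine DenseEnd.mk_eq_of_agree fun x hx _ => ?_
  obtain ⟨h₁, h₂⟩ := mem_pcomp.1 hx
  change (quotTorsionEquiv h).symm (f ⟨quotTorsionEquiv h (F.leftMul r x), _⟩) = F.leftMul _ x
  rw [LinearEquiv.symm_apply_eq]
  refine Eq.trans ?_ (quotTorsionEquiv_leftMul h _ x).symm
  have := f.map_smul (MulOpposite.op (quotTorsionEquiv h x)) ⟨r, hr⟩
  exact (congrArg f (Subtype.ext (quotTorsionEquiv_leftMul h r x))).trans this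

theorem toRingOfQuotients_injective (h : F.torsion = ⊥) :
    Function.Injective F.toRingOfQuotients := by
  refine (injective_iff_map_eq_zero _).2 fun a ha => ?_
  -- Evaluating the dense locus where `a` acts as zero at `1` gives an open right ideal annihilated
  -- by `a`.
  have hd := DenseEnd.mk_eq_mk.1 ha ((quotTorsionEquiv h).symm 1)
  have : a ∈ F.torsion := F.mem_of_le hd fun r hr => by
    obtain ⟨_, _, e⟩ := mem_rightColon.1 hr
    have e : F.leftMul a (MulOpposite.op r • (quotTorsionEquiv h).symm 1) = 0 := e
    rw [← LinearEquiv.map_smul, leftMul_quotTorsionEquiv_symm,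
      LinearEquiv.map_eq_zero_iff] at e
    simpa [mem_rightColon] using e
  rwa [h, Submodule.mem_bot] at this

/-- The class of a partial endomorphism in the ring of right quotients. -/
def RingOfQuotients.mk (f : PartialEnd F (A ⧸ F.torsion)) : F.RingOfQuotients := DenseEnd.mk f

theorem RingOfQuotients.exists_mk_eq (b : F.RingOfQuotients) : ∃ f, RingOfQuotients.mk f = b :=
  Quotient.exists_rep b

theorem mk_mul_toRingOfQuotients (h : F.torsion = ⊥) (f : PartialEnd F (A ⧸ F.torsion)) (r : A)
    (hr : (quotTorsionEquiv h).symm r ∈ f.1.domain) :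
    RingOfQuotients.mk f * F.toRingOfQuotients r =
      F.toRingOfQuotients (quotTorsionEquiv h (f.1 ⟨(quotTorsionEquiv h).symm r, hr⟩)) := by
  refine DenseEnd.mk_eq_of_agree fun x hx _ => ?_
  obtain ⟨h₁, h₂⟩ := mem_pcomp.1 hx
  change f.1 ⟨F.leftMul r x, _⟩ = F.leftMul _ x
  apply (quotTorsionEquiv h).injective
  rw [quotTorsionEquiv_leftMul, ← op_smul_eq_mul, ← LinearEquiv.map_smul, ← LinearPMap.map_smul]
  congr 2
  ext1
  apply (quotTorsionEquiv h).injective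
  simp [quotTorsionEquiv_leftMul]

theorem exists_mul_toRingOfQuotients_mem_range (h : F.torsion = ⊥) (b : F.RingOfQuotients) :
    ∃ R ∈ F.sets, ∀ r ∈ R, b * F.toRingOfQuotients r ∈ F.toRingOfQuotients.range := by
  obtain ⟨f, rfl⟩ := RingOfQuotients.exists_mk_eq b
  -- The denominator ideal is the domain of `f`, transported to `A` as the colon ideal of `1`.
  refine ⟨_, f.2 ((quotTorsionEquiv h).symm 1), fun r hr => ?_⟩
  rw [mem_rightColon, ← LinearEquiv.map_smul] at hr
  exact ⟨_, (mk_mul_toRingOfQuotients h f r (by simpa using hr)).symm⟩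

/-- Multiplying the class of `f` by `r` in its domain returns the value `f(r)`, so `f` vanishes on
the intersection of its domain with `R`, which is dense. -/
theorem eq_zero_of_mul_toRingOfQuotients_eq_zero (h : F.torsion = ⊥) {b : F.RingOfQuotients}
    {R : RightIdeal A} (hR : R ∈ F.sets) (hb : ∀ r ∈ R, b * F.toRingOfQuotients r = 0) : b = 0 := by
  obtain ⟨f, rfl⟩ := RingOfQuotients.exists_mk_eq b
  refine DenseEnd.mk_eq_mk.2 (IsDense.mono (f.2.inf (isDense_comap_quotTorsionEquiv h hR))
    fun x hx => ⟨hx.1, trivial, ?_⟩)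
  have hx' : (quotTorsionEquiv h).symm (quotTorsionEquiv h x) ∈ f.1.domain := by simpa using hx.1
  have e := (mk_mul_toRingOfQuotients h f _ hx').symm.trans (hb _ hx.2)
  have e := toRingOfQuotients_injective h (e.trans (map_zero _).symm)
  rw [LinearEquiv.map_eq_zero_iff] at e
  refine Eq.trans ?_ e
  congr 1
  exact Subtype.ext (by simp)

/-- A family of elements of a right ideal with coordinate functions expresses the unit of the ring
of right quotients. -/
theorem sum_mul_ofHom (h : F.torsion = ⊥) {R : RightIdeal A} (hR : R ∈ F.sets) {ι : Type*}
    [Fintype ι] (y : ι → A) (f : ι → R →ₗ[Aᵐᵒᵖ] A) (hy : ∀ r : R, ∑ j, y j * f j r = r) :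
    ∑ j, F.toRingOfQuotients (y j) * ofHom h hR (f j) = 1 := by
  refine sub_eq_zero.1 (eq_zero_of_mul_toRingOfQuotients_eq_zero h hR fun r hr => ?_)
  rw [sub_mul, Finset.sum_mul, one_mul, sub_eq_zero]
  simp_rw [mul_assoc, ofHom_mul h hR _ r hr, ← map_mul, ← map_sum]
  rw [hy]

end GabrielTopology

/-! ### Ideal topologies of two-sided ideals -/

section IdealTopology

variable {K : Type u} {A : Type u} [Field K] [Ring A] [Algebra K A] {I : RightIdeal A}

/-- Exponents start at one because `I ^ 0` is only the line `K · 1`, which is not an ideal. -/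
theorem mul_mem_pow_of_isTwoSided (hI : ∀ a x : A, x ∈ I → a * x ∈ I) (l : ℕ) (a : A) {x : A}
    (hx : x ∈ (I.restrictScalars K) ^ (l + 1)) : a * x ∈ (I.restrictScalars K) ^ (l + 1) := by
  rw [pow_succ'] at hx ⊢
  induction hx using Submodule.mul_induction_on' with
  | mem_mul_mem m hm n hn =>
    rw [← mul_assoc]
    exact Submodule.mul_mem_mul (hI a m hm) hn
  | add x _ y _ hx hy => rw [mul_add]; exact add_mem hx hy

theorem mul_mem_pow (l : ℕ) (a : A) {x : A}
    (hx : x ∈ (I.restrictScalars K) ^ (l + 1)) : x * a ∈ (I.restrictScalars K) ^ (l + 1) := by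
  rw [pow_succ] at hx ⊢
  induction hx using Submodule.mul_induction_on' with
  | mem_mul_mem m hm n hn =>
    rw [mul_assoc]
    exact Submodule.mul_mem_mul hm (I.smul_mem (MulOpposite.op a) hn)
  | add x _ y _ hx hy => rw [add_mul]; exact add_mem hx hy

variable (K I) in
/-- The power `I ^ (l + 1)` of a right ideal, as a right ideal. -/
def RightIdeal.powSucc (l : ℕ) : RightIdeal A where
  carrier := ((I.restrictScalars K) ^ (l + 1) : Submodule K A)
  add_mem' := add_mem
  zero_mem' := zero_mem _
  smul_mem' c _ hx := mul_mem_pow l c.unop hx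

theorem RightIdeal.mem_powSucc {l : ℕ} {x : A} :
    x ∈ RightIdeal.powSucc K I l ↔ x ∈ (I.restrictScalars K) ^ (l + 1) := Iff.rfl

theorem pow_succ_le_pow_of_isTwoSided (hI : ∀ a x : A, x ∈ I → a * x ∈ I) {k l : ℕ} (h : k ≤ l) :
    (I.restrictScalars K) ^ (l + 1) ≤ (I.restrictScalars K) ^ (k + 1) := by
  induction l, h using Nat.le_induction with
  | base => exact le_rfl
  | succ l _ ih =>
    refine le_trans ?_ ih
    rw [pow_succ']
    exact Submodule.mul_le.2 fun a _ x hx => mul_mem_pow_of_isTwoSided hI l a hx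

theorem RightIdeal.powSucc_antitone (hI : ∀ a x : A, x ∈ I → a * x ∈ I) :
    Antitone (RightIdeal.powSucc K I) := fun k l h x hx => by
  rw [RightIdeal.mem_powSucc] at hx ⊢
  exact pow_succ_le_pow_of_isTwoSided hI h hx

theorem RightIdeal.mem_idealTopology_iff {R : RightIdeal A} :
    R ∈ idealTopology K I ↔ ∃ l, RightIdeal.powSucc K I l ≤ R := by
  refine ⟨fun ⟨l, hl⟩ => ?_, fun ⟨l, hl⟩ => ⟨l + 1, fun x hx => hl hx⟩⟩
  cases l with
  | zero =>
    -- `I ^ 0 ≤ R` puts `1` in `R`, so `R` is everything and any exponent serves.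
    refine ⟨0, fun x _ => ?_⟩
    have h1 : (1 : A) ∈ R := hl (Submodule.one_le.1 (by simp))
    simpa using R.smul_mem (MulOpposite.op x) h1
  | succ l => exact ⟨l, fun x hx => hl hx⟩

/-- Products of generators suffice: a coefficient to the right of a generator of `I` is absorbed
into the next factor, as powers are stable under left multiplication. -/
theorem RightIdeal.powSucc_fg (hI : ∀ a x : A, x ∈ I → a * x ∈ I) (hfg : I.FG) (l : ℕ) :
    (RightIdeal.powSucc K I l).FG := by
  classical
  obtain ⟨s, hs⟩ := hfg
  induction l with
  | zero =>
    refine ⟨s, hs.trans ?_⟩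
    ext x
    simp [RightIdeal.mem_powSucc]
  | succ l ih =>
    obtain ⟨t, ht⟩ := ih
    have hsI : ∀ a ∈ s, a ∈ I := fun a ha => hs ▸ Submodule.subset_span ha
    have htI : ∀ b ∈ t, b ∈ RightIdeal.powSucc K I l := fun b hb => ht ▸ Submodule.subset_span hb
    refine ⟨(s ×ˢ t).image fun p => p.1 * p.2, le_antisymm (Submodule.span_le.2 ?_) fun x hx => ?_⟩
    · intro x hx
      obtain ⟨p, hp, rfl⟩ := Finset.mem_image.1 (Finset.mem_coe.1 hx)
      rw [Finset.mem_product] at hp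
      rw [SetLike.mem_coe, RightIdeal.mem_powSucc, pow_succ']
      exact Submodule.mul_mem_mul (hsI _ hp.1) (htI _ hp.2)
    · rw [RightIdeal.mem_powSucc, pow_succ'] at hx
      induction hx using Submodule.mul_induction_on' with
      | add x _ y _ hx hy => exact add_mem hx hy
      | mem_mul_mem m hm n hn =>
        replace hm : m ∈ Submodule.span Aᵐᵒᵖ (s : Set A) := hs.symm ▸ hm
        induction hm using Submodule.span_induction generalizing n with
        | zero => simp
        | add x y _ _ hx hy => rw [add_mul]; exact add_mem (hx n hn) (hy n hn)
        | smul c x _ hx =>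
          rw [MulOpposite.smul_eq_mul_unop, mul_assoc]
          exact hx _ (mul_mem_pow_of_isTwoSided hI l _ hn)
        | mem x hx =>
          replace hn : n ∈ Submodule.span Aᵐᵒᵖ (t : Set A) := ht.symm ▸ hn
          induction hn using Submodule.span_induction with
          | zero => simp
          | add y z _ _ hy hz => rw [mul_add]; exact add_mem hy hz
          | smul c y _ hy =>
            rw [MulOpposite.smul_eq_mul_unop, ← mul_assoc]
            exact Submodule.smul_mem _ c hy
          | mem y hy =>
            exact Submodule.subset_span (Finset.mem_coe.2
              (Finset.mem_image_of_mem (fun p : A × A => p.1 * p.2) (Finset.mk_mem_product hx hy)))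

variable (K) in
/-- The topology defined by a two-sided ideal that is finitely generated as a right ideal. -/
def GabrielTopology.ofIdeal (hI : ∀ a x : A, x ∈ I → a * x ∈ I) (hfg : I.FG) :
    GabrielTopology A where
  sets := idealTopology K I
  top_mem := ⟨0, le_top⟩
  mem_of_le := fun ⟨l, hl⟩ h => ⟨l, fun _ hx => h (hl hx)⟩
  inf_mem := fun {R S} hR hS => by
    obtain ⟨k, hk⟩ := RightIdeal.mem_idealTopology_iff.1 hR
    obtain ⟨l, hl⟩ := RightIdeal.mem_idealTopology_iff.1 hS
    exact RightIdeal.mem_idealTopology_iff.2 ⟨max k l, le_inf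
      ((RightIdeal.powSucc_antitone hI (le_max_left k l)).trans hk)
      ((RightIdeal.powSucc_antitone hI (le_max_right k l)).trans hl)⟩
  colon_mem := fun {R} hR a => by
    obtain ⟨k, hk⟩ := RightIdeal.mem_idealTopology_iff.1 hR
    refine RightIdeal.mem_idealTopology_iff.2 ⟨k, fun x hx => ?_⟩
    rw [mem_rightColon, op_smul_eq_mul]
    rw [RightIdeal.mem_powSucc] at hx
    exact hk (RightIdeal.mem_powSucc.2 (mul_mem_pow_of_isTwoSided hI k a hx))
  mem_of_colon_mem := fun {R S} hS h => by
    obtain ⟨k, hk⟩ := RightIdeal.mem_idealTopology_iff.1 hS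
    obtain ⟨t, ht⟩ := RightIdeal.powSucc_fg (K := K) hI hfg k
    have htk : ∀ a ∈ t, a ∈ RightIdeal.powSucc K I k := fun a ha => ht ▸ Submodule.subset_span ha
    have h' : ∀ a : A, ∃ l, a ∈ t → RightIdeal.powSucc K I l ≤ rightColon R a := fun a => by
      by_cases ha : a ∈ t
      · obtain ⟨l, hl⟩ := RightIdeal.mem_idealTopology_iff.1 (h a (hk (htk a ha)))
        exact ⟨l, fun _ => hl⟩
      · exact ⟨0, fun ha' => absurd ha' ha⟩
    choose l hl using h'
    -- Finite generation gives one exponent valid for all generators of `I ^ (k + 1)`. The extra `1`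
    -- is the shift in `powSucc`, so the power splits as `I ^ (k + 1) * I ^ (t.sup l + 1)`.
    refine RightIdeal.mem_idealTopology_iff.2 ⟨k + 1 + t.sup l, fun x hx => ?_⟩
    rw [RightIdeal.mem_powSucc, add_assoc, pow_add] at hx
    induction hx using Submodule.mul_induction_on' with
    | add x _ y _ hx hy => exact add_mem hx hy
    | mem_mul_mem m hm n hn =>
      replace hm : m ∈ Submodule.span Aᵐᵒᵖ (t : Set A) := ht.symm ▸ hm
      induction hm using Submodule.span_induction generalizing n with
      | zero => simp
      | add x y _ _ hx hy => rw [add_mul]; exact add_mem (hx n hn) (hy n hn)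
      | smul c x _ hx =>
        rw [MulOpposite.smul_eq_mul_unop, mul_assoc]
        exact hx _ (mul_mem_pow_of_isTwoSided hI _ _ hn)
      | mem x hx =>
        exact hl x hx (RightIdeal.powSucc_antitone hI (Finset.le_sup hx)
          (RightIdeal.mem_powSucc.2 hn))

/-- Insert `1 = ∑ r_j c_j` into the middle of `1 = ∑ r'_i c'_i`: the products `r'_i r_j` lie in the
next power. -/
theorem mem_inducedTopology_of_mem_idealTopology {B : Type u} [Ring B] {φ : A →+* B}
    (hφ : I ∈ inducedTopology φ) {R : RightIdeal A} (hR : R ∈ idealTopology K I) : R ∈ inducedTopology φ := by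
  obtain ⟨l, hl⟩ := (RightIdeal.mem_idealTopology_iff).1 hR
  suffices h : RightIdeal.powSucc K I l ∈ inducedTopology φ from
    eq_top_mono (Submodule.span_mono (Set.image_mono hl)) h
  obtain ⟨m, r, c, hr, h1⟩ := exists_sum_mul_eq_one_of_mem_inducedTopology hφ
  clear hl
  induction l with
  | zero =>
    exact mem_inducedTopology_of_sum_mul_eq_one
      (fun j _ => by simpa [RightIdeal.mem_powSucc] using hr j) h1
  | succ l ih =>
    obtain ⟨m', r', c', hr', h1'⟩ := exists_sum_mul_eq_one_of_mem_inducedTopology ih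
    refine mem_inducedTopology_of_sum_mul_eq_one (s := Finset.univ)
      (r := fun p : Fin m' × Fin m => r' p.1 * r p.2) (c := fun p => c p.2 * c' p.1)
      (fun p _ => ?_) ?_
    · rw [RightIdeal.mem_powSucc, pow_succ]
      exact Submodule.mul_mem_mul (hr' p.1) (hr p.2)
    · rw [Fintype.sum_prod_type]
      simp_rw [map_mul, mul_assoc, ← Finset.mul_sum]
      simp_rw [← mul_assoc (φ (r _)), ← Finset.sum_mul, h1, one_mul, h1']

theorem GabrielTopology.torsion_eq_bot_of_isDomain [IsDomain A] {F : GabrielTopology A}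
    (h : ⊥ ∉ F.sets) : F.torsion = ⊥ := by
  refine eq_bot_iff.2 fun a ha => ?_
  by_contra ha0
  refine h (F.mem_of_le (R := rightColon ⊥ a) ha fun r hr => ?_)
  rw [mem_rightColon, Submodule.mem_bot, op_smul_eq_mul] at hr
  exact (mul_eq_zero.1 hr).resolve_left ha0

theorem bot_notMem_idealTopology [IsDomain A] (h : I ≠ ⊥) : ⊥ ∉ idealTopology K I := by
  rintro ⟨l, hl⟩
  obtain ⟨x, hx, hx0⟩ := I.ne_bot_iff.1 h
  have h : x ^ l ∈ (⊥ : RightIdeal A) := hl (Submodule.pow_mem_pow (I.restrictScalars K) hx l)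
  exact pow_ne_zero l hx0 h

/-- The ring of right quotients for the topology defined by a two-sided ideal that has a finite
dual basis as a right ideal is a perfect localization. -/
theorem GabrielTopology.isPerfectLocalization_toRingOfQuotients {F : GabrielTopology A}
    (hF : F.sets = idealTopology K I) (ht : F.torsion = ⊥)
    {ι : Type*} [Fintype ι] (y : ι → I) (f : ι → I →ₗ[Aᵐᵒᵖ] A)
    (hy : ∀ r : I, ∑ j, (y j : A) * f j r = r) :
    F.IsPerfectLocalization F.toRingOfQuotients where
  injective := toRingOfQuotients_injective ht
  exists_mul_mem := exists_mul_toRingOfQuotients_mem_range ht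
  span_eq_top R hR := by
    have hIF : I ∈ F.sets := hF ▸ ⟨1, by simp⟩
    rw [hF] at hR
    exact mem_inducedTopology_of_mem_idealTopology (mem_inducedTopology_of_sum_mul_eq_one
      (fun j _ => (y j).2) (sum_mul_ofHom ht hIF (fun j => (y j : A)) f hy)) hR

theorem RightIdeal.fg_of_dualBasis {ι : Type*} [Fintype ι] (y : ι → I) (f : ι → I → A)
    (hy : ∀ r : I, ∑ j, (y j : A) * f j r = r) : I.FG := by
  classical
  refine ⟨Finset.univ.image fun j => (y j : A), le_antisymm (Submodule.span_le.2 ?_) fun r hr => ?_⟩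
  · intro x hx
    obtain ⟨j, -, rfl⟩ := Finset.mem_image.1 (Finset.mem_coe.1 hx)
    exact (y j).2
  · rw [show r = ∑ j, (y j : A) * f j ⟨r, hr⟩ from (hy ⟨r, hr⟩).symm]
    exact Submodule.sum_mem _ fun j _ => Submodule.smul_mem _ (MulOpposite.op (f j ⟨r, hr⟩))
      (Submodule.subset_span (by simp))

end IdealTopology

/-! ### Fox calculus and dual bases of right ideals of finite codimension -/

namespace FreeAlgebra

variable {K : Type u} [Field K] {X : Type v} [DecidableEq X] {m : Type*} [Fintype m]
  [DecidableEq m] (ρ : FreeAlgebra K X →ₐ[K] Matrix m m K)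

/-- The block triangular representation whose upper right block is the Fox derivative. -/
noncomputable def foxHom (x : X) :
    FreeAlgebra K X →ₐ[K] Matrix (m ⊕ m) (m ⊕ m) (FreeAlgebra K X) :=
  lift K fun y => Matrix.fromBlocks ((ρ (ι K y)).map (algebraMap K _)) (if y = x then 1 else 0) 0
    (Matrix.scalar m (ι K y))

/-- The Fox derivative with respect to the letter `x`, twisted by a matrix representation. -/
noncomputable def fox (x : X) : FreeAlgebra K X →ₗ[K] Matrix m m (FreeAlgebra K X) where
  toFun a := (foxHom ρ x a).toBlocks₁₂
  map_add' a b := by rw [map_add]; rfl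
  map_smul' c a := by rw [map_smul]; rfl

/-- Since the diagonal blocks are `ρ` and scalar multiplication, multiplicativity of `foxHom` in the
upper right block is the twisted Leibniz rule. -/
theorem foxHom_eq (x : X) (a : FreeAlgebra K X) :
    foxHom ρ x a = Matrix.fromBlocks ((ρ a).map (algebraMap K _)) (fox ρ x a) 0
      (Matrix.scalar m a) := by
  suffices h : (foxHom ρ x a).toBlocks₁₁ = (ρ a).map (algebraMap K _) ∧
      (foxHom ρ x a).toBlocks₂₁ = 0 ∧ (foxHom ρ x a).toBlocks₂₂ = Matrix.scalar m a by
    rw [← Matrix.fromBlocks_toBlocks (foxHom ρ x a), h.1, h.2.1, h.2.2]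
    rfl
  induction a using FreeAlgebra.induction with
  | grade0 k =>
    simp only [AlgHom.commutes]
    refine ⟨?_, ?_, ?_⟩ <;> ext i j <;> by_cases h : i = j <;>
      simp [Matrix.toBlocks₁₁, Matrix.toBlocks₂₁, Matrix.toBlocks₂₂, Matrix.algebraMap_matrix_apply,
        h]
  | grade1 y => simp [foxHom]
  | mul a b ha hb =>
    rw [map_mul, map_mul, map_mul, ← Matrix.fromBlocks_toBlocks (foxHom ρ x a),
      ← Matrix.fromBlocks_toBlocks (foxHom ρ x b), Matrix.fromBlocks_multiply, ha.1, ha.2.1, ha.2.2,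
      hb.1, hb.2.1, hb.2.2, Matrix.map_mul]
    simp
  | add a b ha hb =>
    rw [map_add, map_add, map_add, ← Matrix.fromBlocks_toBlocks (foxHom ρ x a),
      ← Matrix.fromBlocks_toBlocks (foxHom ρ x b), Matrix.fromBlocks_add, ha.1, ha.2.1, ha.2.2,
      hb.1, hb.2.1, hb.2.2, Matrix.map_add _ (map_add _)]
    simp

theorem fox_algebraMap (x : X) (k : K) : fox ρ x (algebraMap K _ k) = 0 := by
  ext i j
  simp [fox, Matrix.toBlocks₁₂, Matrix.algebraMap_matrix_apply]

theorem fox_ι (x y : X) : fox ρ x (ι K y) = if y = x then 1 else 0 := by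
  simp [fox, foxHom]

theorem fox_mul_apply (x : X) (a b : FreeAlgebra K X) (i j : m) :
    fox ρ x (a * b) i j = ∑ k, ρ a i k • fox ρ x b k j + fox ρ x a i j * b := by
  have h : fox ρ x (a * b) =
      (ρ a).map (algebraMap K _) * fox ρ x b + fox ρ x a * Matrix.scalar m b := by
    change (foxHom ρ x (a * b)).toBlocks₁₂ = _
    rw [map_mul, foxHom_eq, foxHom_eq, Matrix.fromBlocks_multiply, Matrix.toBlocks_fromBlocks₁₂]
  rw [h, Matrix.add_apply, Matrix.mul_apply]
  simp [Algebra.smul_def, Matrix.mul_diagonal]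

/-- The fundamental formula of Fox calculus. -/
theorem sum_mul_fox [Fintype X] (v : m → FreeAlgebra K X) (a : FreeAlgebra K X) (i : m) :
    ∑ x, ∑ j, (v j * ι K x - ∑ k, ρ (ι K x) j k • v k) * fox ρ x a i j =
      v i * a - ∑ k, ρ a i k • v k := by
  induction a using FreeAlgebra.induction generalizing i with
  | grade0 c =>
    simp [fox_algebraMap, Matrix.algebraMap_matrix_apply, ite_smul, ← Algebra.commutes,
      ← Algebra.smul_def]
  | grade1 y =>
    rw [Finset.sum_eq_single y]
    · simp [fox_ι, Matrix.one_apply]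
    · intro x _ hx
      simp [fox_ι, hx.symm]
    · simp
  | mul a b ha hb =>
    -- Both sides of the formula obey the same twisted Leibniz rule, so the product case follows
    -- from those of the factors.
    have h : ∀ r : X → m → FreeAlgebra K X, ∑ x, ∑ j, r x j * fox ρ x (a * b) i j =
        ∑ k, ρ a i k • ∑ x, ∑ j, r x j * fox ρ x b k j +
          (∑ x, ∑ j, r x j * fox ρ x a i j) * b := fun r => by
      simp only [fox_mul_apply, mul_add, Finset.sum_add_distrib, Finset.mul_sum, Finset.sum_mul,
        Finset.smul_sum, mul_smul_comm, mul_assoc]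
      congr 1
      exact (Finset.sum_congr rfl fun _ _ => Finset.sum_comm).trans Finset.sum_comm
    have h' : ∑ k, ρ a i k • ∑ l, ρ b k l • v l = ∑ l, ρ (a * b) i l • v l := by
      simp_rw [map_mul, Matrix.mul_apply, Finset.smul_sum, Finset.sum_smul, smul_smul]
      exact Finset.sum_comm
    rw [h, ha]
    simp_rw [hb, smul_sub, Finset.sum_sub_distrib, h', sub_mul, Finset.sum_mul, smul_mul_assoc,
      mul_assoc]
    abel
  | add a b ha hb =>
    simp only [map_add, Matrix.add_apply, mul_add, Finset.sum_add_distrib, ha, hb, add_smul]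
    abel

/-- The coordinate function on a right ideal given by a combination of Fox derivatives. -/
noncomputable def foxCoord (I : RightIdeal (FreeAlgebra K X)) (u : m → K)
    (hu : ∀ a ∈ I, ∀ j, ∑ i, u i * ρ a i j = 0) (x : X) (j : m) :
    I →ₗ[(FreeAlgebra K X)ᵐᵒᵖ] FreeAlgebra K X where
  toFun a := ∑ i, u i • fox ρ x (a : FreeAlgebra K X) i j
  map_add' a b := by simp [Finset.sum_add_distrib]
  map_smul' c a := by
    -- The Leibniz term that obstructs right linearity carries the factor `u ρ(a)`, which is zero on
    -- `I`.
    have h : ∑ i, u i • ∑ k, ρ (a : FreeAlgebra K X) i k • fox ρ x c.unop k j = 0 := by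
      simp_rw [Finset.smul_sum, smul_smul]
      rw [Finset.sum_comm]
      simp_rw [← Finset.sum_smul, hu a a.2, zero_smul, Finset.sum_const_zero]
    simp only [Submodule.coe_smul, MulOpposite.smul_eq_mul_unop, fox_mul_apply, smul_add,
      Finset.sum_add_distrib, h, zero_add, RingHom.id_apply, Finset.sum_mul, smul_mul_assoc]

/-- Contract the fundamental formula with `u`; on `I` the term involving `ρ(a)` disappears. -/
theorem sum_mul_foxCoord [Fintype X] (I : RightIdeal (FreeAlgebra K X)) (u : m → K)
    (hu : ∀ a ∈ I, ∀ j, ∑ i, u i * ρ a i j = 0) (v : m → FreeAlgebra K X) (a : I) :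
    ∑ x, ∑ j, (v j * ι K x - ∑ k, ρ (ι K x) j k • v k) * foxCoord ρ I u hu x j a =
      (∑ i, u i • v i) * a := by
  have h := fun i => sum_mul_fox ρ v (a : FreeAlgebra K X) i
  have h0 : ∑ i, u i • ∑ k, ρ (a : FreeAlgebra K X) i k • v k = 0 := by
    simp_rw [Finset.smul_sum, smul_smul]
    rw [Finset.sum_comm]
    simp_rw [← Finset.sum_smul, hu a a.2, zero_smul, Finset.sum_const_zero]
  calc _ = ∑ i, u i • ∑ x, ∑ j, (v j * ι K x - ∑ k, ρ (ι K x) j k • v k) *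
        fox ρ x (a : FreeAlgebra K X) i j := by
        simp only [foxCoord, LinearMap.coe_mk, AddHom.coe_mk, Finset.mul_sum, Finset.smul_sum,
          mul_smul_comm]
        rw [Finset.sum_comm (s := (Finset.univ : Finset m))]
        exact Finset.sum_congr rfl fun _ _ => Finset.sum_comm
    _ = _ := by
        simp_rw [h, smul_sub, Finset.sum_sub_distrib, h0, sub_zero, Finset.sum_mul, smul_mul_assoc]

section QuotientRep

variable {I : RightIdeal (FreeAlgebra K X)} (b : Module.Basis m K (FreeAlgebra K X ⧸ I))

omit [DecidableEq X] [DecidableEq m] in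
-- Coordinates are row vectors acted on from the right, which makes `quotientRep` multiplicative
-- rather than antimultiplicative.
theorem sum_repr_mul_repr (x : FreeAlgebra K X ⧸ I) (a : FreeAlgebra K X) (j : m) :
    ∑ i, b.repr x i * b.repr (MulOpposite.op a • b i) j = b.repr (MulOpposite.op a • x) j := by
  conv_rhs => rw [← b.sum_repr x]
  have : ∀ (c : K) (y : FreeAlgebra K X ⧸ I),
      MulOpposite.op a • (c • y) = c • (MulOpposite.op a • y) := fun c y => by
    obtain ⟨y, rfl⟩ := Submodule.Quotient.mk_surjective _ y
    rw [← Submodule.Quotient.mk_smul, ← Submodule.Quotient.mk_smul, ← Submodule.Quotient.mk_smul,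
      ← Submodule.Quotient.mk_smul]
    simp
  simp only [Finset.smul_sum, this, map_sum, map_smul, Finsupp.finsetSum_apply, Finsupp.smul_apply,
    smul_eq_mul]

/-- The matrix representation on the quotient by a right ideal. -/
noncomputable def quotientRep : FreeAlgebra K X →ₐ[K] Matrix m m K :=
  AlgHom.ofLinearMap
    { toFun := fun a => Matrix.of fun i j => b.repr (MulOpposite.op a • b i) j
      map_add' := fun a c => by ext; simp [add_smul]
      map_smul' := fun k a => by
        ext i j
        have : MulOpposite.op (k • a) • b i = k • (MulOpposite.op a • b i) := by
          obtain ⟨y, hy⟩ := Submodule.Quotient.mk_surjective _ (b i)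
          rw [← hy, ← Submodule.Quotient.mk_smul, ← Submodule.Quotient.mk_smul,
            ← Submodule.Quotient.mk_smul]
          simp
        simp [-MulOpposite.op_smul, this] }
    (by ext i j; simp [Matrix.one_apply, Finsupp.single_apply])
    (fun a c => by
      ext i j
      simp [Matrix.mul_apply, sum_repr_mul_repr, mul_smul])

omit [DecidableEq X] in
theorem quotientRep_apply (a : FreeAlgebra K X) (i j : m) :
    quotientRep b a i j = b.repr (MulOpposite.op a • b i) j := rfl

end QuotientRep

/-- A right ideal of finite codimension in a free algebra of finite rank has a finite dual basis. -/
theorem exists_dualBasis [Fintype X] (I : RightIdeal (FreeAlgebra K X))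
    [FiniteDimensional K (FreeAlgebra K X ⧸ I)] :
    ∃ (J : Type v) (_ : Fintype J) (y : J → I)
      (f : J → I →ₗ[(FreeAlgebra K X)ᵐᵒᵖ] FreeAlgebra K X),
      ∀ r : I, ∑ j, (y j : FreeAlgebra K X) * f j r = r := by
  let b := Module.finBasis K (FreeAlgebra K X ⧸ I)
  choose v hv using fun j => Submodule.Quotient.mk_surjective I (b j)
  let u := fun j => b.repr (Submodule.Quotient.mk 1) j
  -- As `u` is the coordinate vector of the class of `1`, `u ρ(a)` is that of the class of `a`.
  have hu : ∀ a ∈ I, ∀ j, ∑ i, u i * quotientRep b a i j = 0 := fun a ha j => by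
    simp_rw [quotientRep_apply, u, sum_repr_mul_repr]
    rw [← Submodule.Quotient.mk_smul, op_smul_eq_mul, one_mul,
      (Submodule.Quotient.mk_eq_zero I).2 ha, map_zero, Finsupp.zero_apply]
  have hmk : ∀ (s : Fin _ → K), Submodule.Quotient.mk (p := I) (∑ k, s k • v k) =
      ∑ k, s k • b k := fun s => by
    rw [← Submodule.mkQ_apply, map_sum]
    exact Finset.sum_congr rfl fun k _ => by
      rw [Submodule.mkQ_apply, Submodule.Quotient.mk_smul, hv]
  have hy₀ : 1 - ∑ i, u i • v i ∈ I := by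
    rw [← Submodule.Quotient.mk_eq_zero, Submodule.Quotient.mk_sub, hmk, b.sum_repr, sub_self]
  have hy : ∀ x j, v j * ι K x - ∑ k, quotientRep b (ι K x) j k • v k ∈ I := fun x j => by
    rw [← Submodule.Quotient.mk_eq_zero, Submodule.Quotient.mk_sub, hmk, ← op_smul_eq_mul,
      Submodule.Quotient.mk_smul, hv]
    simp_rw [quotientRep_apply, b.sum_repr, sub_self]
  -- The Fox terms sum to `(∑ u_i v_i) r`. The additional index `none`, with element `1 - ∑ u_i v_i`
  -- and the inclusion as coordinate, supplies the rest of `r`.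
  refine ⟨Option (X × Fin _), inferInstance, fun o => o.elim ⟨_, hy₀⟩ fun p => ⟨_, hy p.1 p.2⟩,
    fun o => o.elim I.subtype fun p => foxCoord (quotientRep b) I u hu p.1 p.2, fun r => ?_⟩
  rw [Fintype.sum_option, Fintype.sum_prod_type]
  simp only [Option.elim]
  rw [sum_mul_foxCoord, Submodule.subtype_apply, sub_mul, one_mul, sub_add_cancel]

omit [DecidableEq X] in
theorem ne_bot_of_finiteDimensional_quotient [Nonempty X] (I : RightIdeal (FreeAlgebra K X))
    [FiniteDimensional K (FreeAlgebra K X ⧸ I)] : I ≠ ⊥ := by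
  rintro rfl
  have h₁ : FiniteDimensional K (FreeAlgebra K X) :=
    Module.Finite.equiv ((Submodule.quotEquivOfEqBot (⊥ : RightIdeal (FreeAlgebra K X))
      rfl).restrictScalars K)
  -- A free algebra on a nonempty set maps onto `K[X]`, so it has infinite dimension and zero has
  -- infinite codimension.
  let f : FreeAlgebra K X →ₐ[K] Polynomial K := lift K fun _ => Polynomial.X
  have hf : Function.Surjective f := by
    rw [← AlgHom.range_eq_top, eq_top_iff, ← Polynomial.adjoin_X, Algebra.adjoin_le_iff]
    rintro _ rfl
    exact ⟨ι K (Classical.arbitrary X), by simp [f]⟩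
  exact Polynomial.not_finite (Module.Finite.of_surjective f.toLinearMap hf)

end FreeAlgebra

/-! ### Presentation of the Leavitt algebra -/

namespace LeavittAlgebra

variable (K : Type u) [Field K] (n : ℕ)

/-- The generator `a_i^*` of the Leavitt algebra. -/
def aStar (i : Fin n) : LeavittAlgebra K n :=
  RingQuot.mkAlgHom K (LeavittRel K n) (leavittGen K n (Sum.inr i))

theorem aStar_mul_a (i j : Fin n) : aStar K n j * a K n i = if j = i then 1 else 0 := by
  rw [aStar, a, ← map_mul, RingQuot.mkAlgHom_rel K (LeavittRel.star_mul i j)]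
  split_ifs <;> simp

theorem sum_a_mul_aStar : ∑ i, a K n i * aStar K n i = 1 := by
  simp_rw [aStar, a, ← map_mul, ← map_sum]
  rw [RingQuot.mkAlgHom_rel K LeavittRel.sum_mul_star, map_one]

variable {K n}

/-- The universal property of the Leavitt algebra. -/
noncomputable def lift {B : Type*} [Ring B] [Algebra K B] (f g : Fin n → B)
    (hgf : ∀ i j, g j * f i = if j = i then 1 else 0) (hfg : ∑ i, f i * g i = 1) :
    LeavittAlgebra K n →ₐ[K] B :=
  RingQuot.liftAlgHom K ⟨FreeAlgebra.lift K (Sum.elim f g), fun x y h => by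
    cases h with
    | star_mul i j => rw [map_mul]; simp [hgf, apply_ite (FreeAlgebra.lift K (Sum.elim f g))]
    | sum_mul_star => simp [hfg]⟩

theorem lift_a {B : Type*} [Ring B] [Algebra K B] (f g : Fin n → B)
    (hgf : ∀ i j, g j * f i = if j = i then 1 else 0) (hfg : ∑ i, f i * g i = 1) (i : Fin n) :
    lift f g hgf hfg (a K n i) = f i := by
  simp [lift, a]

@[elab_as_elim]
theorem induction_on {p : LeavittAlgebra K n → Prop} (z : LeavittAlgebra K n)
    (algebraMap : ∀ k : K, p (algebraMap K _ k)) (a : ∀ i, p (a K n i))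
    (aStar : ∀ i, p (aStar K n i)) (mul : ∀ x y, p x → p y → p (x * y))
    (add : ∀ x y, p x → p y → p (x + y)) : p z := by
  obtain ⟨w, rfl⟩ := RingQuot.mkAlgHom_surjective K (LeavittRel K n) z
  induction w using FreeAlgebra.induction with
  | grade0 k => rw [AlgHom.commutes]; exact algebraMap k
  | grade1 x =>
    cases x with
    | inl i => exact a i
    | inr i => exact aStar i
  | mul x y hx hy => rw [map_mul]; exact mul _ _ hx hy
  | add x y hx hy => rw [map_add]; exact add _ _ hx hy

end LeavittAlgebra

/-! ### Right ideals of codimension one and the Leavitt algebra -/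

section CodimensionOne

variable {K : Type u} [Field K] {n : ℕ} {I : RightIdeal (FreeAlgebra K (Fin n))} {c : Fin n → K}

namespace FreeAlgebra

variable (K) in
/-- The one-dimensional representation of the free algebra with values `c`. -/
noncomputable def charRep (c : Fin n → K) : FreeAlgebra K (Fin n) →ₐ[K] Matrix Unit Unit K :=
  lift K fun i => Matrix.of fun _ _ => c i

theorem sum_mul_fox_charRep (c : Fin n → K) (a : FreeAlgebra K (Fin n)) :
    ∑ i, (ι K i - algebraMap K _ (c i)) * fox (charRep K c) i a () () =
      a - algebraMap K _ (charRep K c a () ()) := by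
  simpa [charRep, Algebra.smul_def] using sum_mul_fox (charRep K c) (fun _ => 1) a ()

theorem sub_charRep_mem (hc : ∀ i, ι K i - algebraMap K _ (c i) ∈ I) (a : FreeAlgebra K (Fin n)) :
    a - algebraMap K _ (charRep K c a () ()) ∈ I := by
  rw [← sum_mul_fox_charRep]
  exact I.sum_mem fun i _ =>
    I.smul_mem (MulOpposite.op (fox (charRep K c) i a () ())) (hc i)

/-- Modulo `I` every `a` is a scalar, and scalars commute with `x`. -/
theorem mul_mem_of_sub_mem (hc : ∀ i, ι K i - algebraMap K _ (c i) ∈ I)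
    (a x : FreeAlgebra K (Fin n)) (hx : x ∈ I) : a * x ∈ I := by
  have h : a * x = (a - algebraMap K _ (charRep K c a () ())) * x +
      x * algebraMap K _ (charRep K c a () ()) := by
    rw [sub_mul, Algebra.commutes, sub_add_cancel]
  rw [h]
  exact I.add_mem (I.smul_mem (MulOpposite.op x) (sub_charRep_mem hc a))
    (I.smul_mem (MulOpposite.op (algebraMap K _ (charRep K c a () ()))) hx)

theorem eq_zero_of_algebraMap_mem (hI : I ≠ ⊤) {k : K} (hk : algebraMap K _ k ∈ I) : k = 0 := by
  by_contra h
  refine hI (eq_top_iff.2 fun x _ => ?_)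
  have := I.smul_mem (MulOpposite.op (algebraMap K _ k⁻¹ * x)) hk
  rwa [op_smul_eq_mul, ← mul_assoc, ← map_mul, mul_inv_cancel₀ h, map_one, one_mul] at this

theorem charRep_eq_zero (hI : I ≠ ⊤) (hc : ∀ i, ι K i - algebraMap K _ (c i) ∈ I)
    (a : FreeAlgebra K (Fin n)) (ha : a ∈ I) : charRep K c a () () = 0 :=
  eq_zero_of_algebraMap_mem hI (by simpa using I.sub_mem ha (sub_charRep_mem hc a))

/-- The coordinates on a right ideal of codimension one with respect to the basis `x_i - c_i`. -/
noncomputable def charCoord (hI : I ≠ ⊤) (hc : ∀ i, ι K i - algebraMap K _ (c i) ∈ I) (i : Fin n) :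
    I →ₗ[(FreeAlgebra K (Fin n))ᵐᵒᵖ] FreeAlgebra K (Fin n) :=
  foxCoord (charRep K c) I (fun _ => 1) (fun a ha _ => by simp [charRep_eq_zero hI hc a ha]) i ()

theorem sum_mul_charCoord (hI : I ≠ ⊤) (hc : ∀ i, ι K i - algebraMap K _ (c i) ∈ I) (r : I) :
    ∑ i, (ι K i - algebraMap K _ (c i)) * charCoord hI hc i r = r := by
  simpa [charRep, charCoord, Algebra.smul_def] using sum_mul_foxCoord (charRep K c) I (fun _ => 1)
    (fun a ha _ => by simp [charRep_eq_zero hI hc a ha]) (fun _ => 1) r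

/-- This duality becomes the relation `a_j^* a_i = δ_{ij}` in the ring of quotients. -/
theorem charCoord_apply (hI : I ≠ ⊤) (hc : ∀ i, ι K i - algebraMap K _ (c i) ∈ I) (i j : Fin n) :
    charCoord hI hc j ⟨_, hc i⟩ = if j = i then 1 else 0 := by
  have h := fox_ι (charRep K c) j i
  simp only [charCoord, foxCoord, LinearMap.coe_mk, AddHom.coe_mk, Finset.univ_unique,
    Finset.sum_singleton, one_smul, map_sub, fox_algebraMap, sub_zero, h, eq_comm (a := j)]
  split_ifs <;> simp

theorem exists_sub_algebraMap_mem (h : Module.finrank K (FreeAlgebra K (Fin n) ⧸ I) = 1)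
    (a : FreeAlgebra K (Fin n)) : ∃ k : K, a - algebraMap K _ k ∈ I := by
  have h1 : (Submodule.Quotient.mk 1 : FreeAlgebra K (Fin n) ⧸ I) ≠ 0 := fun h1 => by
    have hI : I = ⊤ := eq_top_iff.2 fun x _ => by
      simpa using I.smul_mem (MulOpposite.op x) ((Submodule.Quotient.mk_eq_zero I).1 h1)
    subst hI
    rw [Module.finrank_zero_of_subsingleton] at h
    exact zero_ne_one h
  obtain ⟨k, hk⟩ := (finrank_eq_one_iff_of_nonzero' _ h1).1 h (Submodule.Quotient.mk a)
  refine ⟨k, (Submodule.Quotient.mk_eq_zero I).1 ?_⟩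
  rw [Submodule.Quotient.mk_sub, ← hk, ← Submodule.Quotient.mk_smul, ← Algebra.algebraMap_eq_smul_one,
    sub_self]

end FreeAlgebra

variable (c) in
/-- The homomorphism to the Leavitt algebra sending `x_i - c_i` to `a_i`. -/
noncomputable def FreeAlgebra.toLeavitt : FreeAlgebra K (Fin n) →ₐ[K] LeavittAlgebra K n :=
  FreeAlgebra.lift K fun i => LeavittAlgebra.a K n i + algebraMap K _ (c i)

open FreeAlgebra

theorem FreeAlgebra.toLeavitt_sub (i : Fin n) :
    toLeavitt c (ι K i - algebraMap K _ (c i)) = LeavittAlgebra.a K n i := by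
  simp [toLeavitt]

theorem LeavittAlgebra.aStar_mul_toLeavitt (hI : I ≠ ⊤)
    (hc : ∀ i, ι K i - algebraMap K _ (c i) ∈ I) (j : Fin n) (r : I) :
    aStar K n j * toLeavitt c r = toLeavitt c (charCoord hI hc j r) := by
  conv_lhs => rw [← sum_mul_charCoord hI hc r]
  simp [-map_sub, toLeavitt_sub, Finset.mul_sum, ← mul_assoc, aStar_mul_a]

/-- Denominators for `z`: each `a_i^*` costs one power of `I`, being a coordinate function there.
Requiring the result to land in a prescribed power lets the bounds for two factors be chained. -/
theorem LeavittAlgebra.exists_mul_toLeavitt_mem (hI : I ≠ ⊤)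
    (hc : ∀ i, ι K i - algebraMap K _ (c i) ∈ I) (z : LeavittAlgebra K n) (k : ℕ) :
    ∃ l, ∀ r ∈ RightIdeal.powSucc K I l, ∃ s ∈ RightIdeal.powSucc K I k,
      z * toLeavitt c r = toLeavitt c s := by
  have hI₂ := mul_mem_of_sub_mem hc
  have hmul : ∀ {a x}, x ∈ RightIdeal.powSucc K I k → a * x ∈ RightIdeal.powSucc K I k :=
    fun {a x} hx => RightIdeal.mem_powSucc.2
      (mul_mem_pow_of_isTwoSided hI₂ k a (RightIdeal.mem_powSucc.1 hx))
  induction z using LeavittAlgebra.induction_on generalizing k with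
  | algebraMap t => exact ⟨k, fun r hr => ⟨algebraMap K _ t * r, hmul hr, by simp⟩⟩
  | a i =>
    exact ⟨k, fun r hr => ⟨(ι K i - algebraMap K _ (c i)) * r, hmul hr, by
      rw [map_mul, toLeavitt_sub]⟩⟩
  | aStar i =>
    refine ⟨k + 1, fun r hr => ?_⟩
    rw [RightIdeal.mem_powSucc, pow_succ'] at hr
    induction hr using Submodule.mul_induction_on' with
    | mem_mul_mem m hm s hs =>
      refine ⟨charCoord hI hc i ⟨m, hm⟩ * s, hmul (RightIdeal.mem_powSucc.2 hs), ?_⟩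
      rw [map_mul, map_mul, ← mul_assoc, ← aStar_mul_toLeavitt]
    | add x _ y _ hx hy =>
      obtain ⟨s, hs, hx⟩ := hx
      obtain ⟨t, ht, hy⟩ := hy
      exact ⟨s + t, add_mem hs ht, by rw [map_add, mul_add, hx, hy, map_add]⟩
  | mul x y hx hy =>
    obtain ⟨l, hl⟩ := hx k hmul
    obtain ⟨l', hl'⟩ := hy l fun {a x} hx => RightIdeal.mem_powSucc.2
      (mul_mem_pow_of_isTwoSided hI₂ l a (RightIdeal.mem_powSucc.1 hx))
    refine ⟨l', fun r hr => ?_⟩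
    obtain ⟨s, hs, h⟩ := hl' r hr
    obtain ⟨t, ht, h'⟩ := hl s hs
    exact ⟨t, ht, by rw [mul_assoc, h, h']⟩
  | add x y hx hy =>
    obtain ⟨l, hl⟩ := hx k hmul
    obtain ⟨l', hl'⟩ := hy k hmul
    refine ⟨max l l', fun r hr => ?_⟩
    obtain ⟨s, hs, h⟩ := hl r (RightIdeal.powSucc_antitone hI₂ (le_max_left l l') hr)
    obtain ⟨t, ht, h'⟩ := hl' r (RightIdeal.powSucc_antitone hI₂ (le_max_right l l') hr)
    exact ⟨s + t, add_mem hs ht, by rw [add_mul, h, h', map_add]⟩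

/-- The canonical homomorphism to the ring of right quotients as a homomorphism of algebras. -/
def GabrielTopology.toRingOfQuotientsAlgHom (K : Type v) [Field K] {A : Type u} [Ring A]
    [Algebra K A] (F : GabrielTopology A) : A →ₐ[K] F.RingOfQuotients :=
  { F.toRingOfQuotients with commutes' := fun _ => rfl }

/-- The universal property of the Leavitt algebra gives a map into the ring of quotients, with
`a_i^*` sent to the `i`-th coordinate function; `e` is its inverse. -/
theorem exists_ringOfQuotients_algEquiv_leavittAlgebra
    {F : GabrielTopology (FreeAlgebra K (Fin n))} (hF : F.sets = idealTopology K I)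
    (ht : F.torsion = ⊥) (hφ : F.IsPerfectLocalization F.toRingOfQuotients) (hI : I ≠ ⊤)
    (hc : ∀ i, ι K i - algebraMap K _ (c i) ∈ I) :
    ∃ e : F.RingOfQuotients ≃ₐ[K] LeavittAlgebra K n, ∀ i,
      e (F.toRingOfQuotients (ι K i - algebraMap K _ (c i))) = LeavittAlgebra.a K n i := by
  have hIF : I ∈ F.sets := hF ▸ ⟨1, by simp⟩
  let θ : LeavittAlgebra K n →ₐ[K] F.RingOfQuotients := LeavittAlgebra.lift
    (fun i => F.toRingOfQuotients (ι K i - algebraMap K _ (c i)))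
    (fun i => GabrielTopology.ofHom ht hIF (charCoord hI hc i))
    (fun i j => by
      rw [GabrielTopology.ofHom_mul ht hIF _ _ (hc i), charCoord_apply]
      split_ifs <;> simp)
    (GabrielTopology.sum_mul_ofHom ht hIF _ _ (sum_mul_charCoord hI hc))
  have hθa : ∀ i, θ (LeavittAlgebra.a K n i) =
      F.toRingOfQuotients (ι K i - algebraMap K _ (c i)) := LeavittAlgebra.lift_a _ _ _ _
  have hθ : θ.comp (toLeavitt c) = F.toRingOfQuotientsAlgHom K := by
    ext i
    change θ (toLeavitt c (ι K i)) = F.toRingOfQuotients (ι K i)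
    rw [← sub_add_cancel (ι K i) (algebraMap K _ (c i)), map_add, toLeavitt_sub, map_add, hθa,
      map_add, AlgHom.commutes, AlgHom.commutes]
    rfl
  have hbij : Function.Bijective (θ : LeavittAlgebra K n →+* F.RingOfQuotients) := by
    refine hφ.bijective_of_comp_eq (ψ := (toLeavitt c : _ →+* LeavittAlgebra K n)) _
      (RingHom.ext fun a => AlgHom.congr_fun hθ a) (fun z => ?_) fun R hR => ?_
    -- Only membership in the image matters here, so the target exponent `0` is arbitrary.
    · obtain ⟨l, hl⟩ := LeavittAlgebra.exists_mul_toLeavitt_mem hI hc z 0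
      refine ⟨RightIdeal.powSucc K I l, hF ▸ RightIdeal.mem_idealTopology_iff.2 ⟨l, le_rfl⟩,
        fun r hr => ?_⟩
      obtain ⟨s, -, h⟩ := hl r hr
      exact ⟨s, h.symm⟩
    · rw [hF] at hR
      refine mem_inducedTopology_of_mem_idealTopology (mem_inducedTopology_of_sum_mul_eq_one
        (s := Finset.univ) (c := LeavittAlgebra.aStar K n) (fun i _ => hc i) ?_) hR
      refine Eq.trans (Finset.sum_congr rfl fun i _ => ?_) (LeavittAlgebra.sum_a_mul_aStar K n)
      exact congrArg (· * _) (toLeavitt_sub i)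
  refine ⟨(AlgEquiv.ofBijective θ hbij).symm, fun i => ?_⟩
  rw [← hθa]
  exact (AlgEquiv.ofBijective θ hbij).symm_apply_apply _

end CodimensionOne

/-! ### Conclusion -/

theorem exists_gabrielTopology_of_finiteDimensional {K : Type u} [Field K] {n : ℕ} (hn : 1 < n)
    (I : RightIdeal (FreeAlgebra K (Fin n))) (hI : ∀ a x : FreeAlgebra K (Fin n), x ∈ I → a * x ∈ I)
    (hfd : FiniteDimensional K (FreeAlgebra K (Fin n) ⧸ I)) :
    ∃ F : GabrielTopology (FreeAlgebra K (Fin n)), F.sets = idealTopology K I ∧ F.torsion = ⊥ ∧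
      F.IsPerfectLocalization F.toRingOfQuotients := by
  obtain ⟨J, _, y, f, hy⟩ := FreeAlgebra.exists_dualBasis I
  have : Nonempty (Fin n) := ⟨⟨0, by omega⟩⟩
  have ht : (GabrielTopology.ofIdeal K hI (RightIdeal.fg_of_dualBasis y (fun j => f j) hy)).torsion
      = ⊥ := GabrielTopology.torsion_eq_bot_of_isDomain
    (bot_notMem_idealTopology (FreeAlgebra.ne_bot_of_finiteDimensional_quotient I))
  exact ⟨_, rfl, ht, GabrielTopology.isPerfectLocalization_toRingOfQuotients rfl ht y f hy⟩

theorem corollary3p9 {K : Type u} [Field K] (n : ℕ) (hn : 1 < n) :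
    (∀ I : RightIdeal (FreeAlgebra K (Fin n)),
      Module.finrank K (FreeAlgebra K (Fin n) ⧸ I) = 1 →
      ∃ F : GabrielTopology (FreeAlgebra K (Fin n)),
        F.sets = idealTopology K I ∧
        IsFlatBimorphism F.toRingOfQuotients ∧
        F.sets = inducedTopology F.toRingOfQuotients ∧
        ∃ e : F.RingOfQuotients ≃ₐ[K] LeavittAlgebra K n,
          (∀ (i : Fin n) (c : K), FreeAlgebra.ι K i - algebraMap K _ c ∈ I →
            e (F.toRingOfQuotients (FreeAlgebra.ι K i - algebraMap K _ c)) =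
              LeavittAlgebra.a K n i) ∧
          IsFlatBimorphism ((e : F.RingOfQuotients →+* LeavittAlgebra K n).comp
            F.toRingOfQuotients) ∧
          F.sets = inducedTopology ((e : F.RingOfQuotients →+* LeavittAlgebra K n).comp
            F.toRingOfQuotients)) ∧
    (∀ I : RightIdeal (FreeAlgebra K (Fin n)),
      (∀ a x : FreeAlgebra K (Fin n), x ∈ I → a * x ∈ I) →
      FiniteDimensional K (FreeAlgebra K (Fin n) ⧸ I) →
      ∃ F : GabrielTopology (FreeAlgebra K (Fin n)),
        F.sets = idealTopology K I ∧
        IsFlatBimorphism F.toRingOfQuotients ∧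
        F.sets = inducedTopology F.toRingOfQuotients) := by
  refine ⟨fun I h => ?_, fun I hI hfd => ?_⟩
  · have hI : I ≠ ⊤ := by
      rintro rfl
      rw [Module.finrank_zero_of_subsingleton] at h
      exact zero_ne_one h
    choose c hc using fun i => FreeAlgebra.exists_sub_algebraMap_mem h (FreeAlgebra.ι K i)
    obtain ⟨F, hF, ht, hφ⟩ := exists_gabrielTopology_of_finiteDimensional hn I
      (FreeAlgebra.mul_mem_of_sub_mem hc) (Module.finite_of_finrank_eq_succ h)
    obtain ⟨e, he⟩ := exists_ringOfQuotients_algEquiv_leavittAlgebra hF ht hφ hI hc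
    have heφ := hφ.comp_ringEquiv e.toRingEquiv
    refine ⟨F, hF, hφ.isFlatBimorphism, hφ.sets_eq_inducedTopology, e, fun i k hk => ?_,
      heφ.isFlatBimorphism, heφ.sets_eq_inducedTopology⟩
    -- The scalar is unique: two choices differ by a scalar in the proper right ideal `I`.
    have hck : c i - k = 0 := FreeAlgebra.eq_zero_of_algebraMap_mem hI (by
      simpa using I.sub_mem hk (hc i))
    rw [← sub_eq_zero.1 hck, he]
  · obtain ⟨F, hF, -, hφ⟩ := exists_gabrielTopology_of_finiteDimensional hn I hI hfd
    exact ⟨F, hF, hφ.isFlatBimorphism, hφ.sets_eq_inducedTopology⟩
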